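/- Let $(M,\omega_{-1})$ be a Kähler manifold of complex dimension $n$; in local holomorphic coordinates $z^k$ write $\omega_{-1}=i\,g_{kl}\,dz^k\wedge d\bar z^l$, let $(g^{lk})$ be the inverse matrix of $(g_{kl})$, and sum over repeated indices. Let $\zeta^k,\bar\zeta^l$ be the fibre coordinates on $TM$ in the frame $\partial/\partial z^k,\partial/\partial\bar z^l$. Let $\mathcal W$ be the space of sections of the bundle of formal Wick algebras, i.e. of formal series $\sum_{r\ge r_0}\sum_{\alpha,\beta}\nu^r w_{r,\alpha,\beta}(z,\bar z)\zeta^\alpha\bar\zeta^\beta$ with smooth coefficients and $r_0\in\mathbb Z$, with the fibrewise Wick product $$f\circ h=\sum_{r\ge0}\frac{\nu^r}{r!}\,g^{l_1k_1}\cdots g^{l_rk_r}\,\frac{\partial^r f}{\partial\bar\zeta^{l_1}\cdots\partial\bar\zeta^{l_r}}\,\frac{\partial^r h}{\partial\zeta^{k_1}\cdots\partial\zeta^{k_r}},$$ extended to $\mathcal W\otimes\Lambda$ by the wedge product of differential forms. Let $\mathcal V\subset\mathcal W$ (sections of the formal Fock bundle $\mathbf V$) consist of the series without $\bar\zeta$,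 let $\Pi'w=w|_{\bar\zeta=0}$, and let $w\in\mathcal W\otimes\Lambda$ act on $v\in\mathcal V\otimes\Lambda$ by $\hat w v=\Pi'(w\circ v)$. Let $$\nabla=d-\Gamma^s_{ki}\zeta^i\frac{\partial}{\partial\zeta^s}dz^k-\Gamma^{\bar t}_{\bar l\bar j}\bar\zeta^j\frac{\partial}{\partial\bar\zeta^t}d\bar z^l,\qquad \Gamma^s_{ki}=g^{ls}\frac{\partial g_{kl}}{\partial z^i},\quad \Gamma^{\bar t}_{\bar l\bar j}=g^{tk}\frac{\partial g_{kl}}{\partial\bar z^j},$$ be the Kähler connection on $\mathcal W\otimes\Lambda$ and $\hat\nabla=d-\Gamma^s_{ki}\zeta^i\frac{\partial}{\partial\zeta^s}dz^k$ its restriction to $\mathcal V\otimes\Lambda$. Put $R=(-g^{ts}\,\partial g_{kt}\wedge\bar\partial g_{sl}+\partial\bar\partial g_{kl})\zeta^k\bar\zeta^l$, $\delta=\frac{\partial}{\partial\zeta^k}dz^k+\frac{\partial}{\partial\bar\zeta^l}d\bar z^l$ and $\vartheta=g_{kl}\bar\zeta^l dz^k-g_{kl}\zeta^k d\bar z^l$;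 on $q$-forms homogeneous of degree $p$ in $(\zeta,\bar\zeta)$ let $\delta^{-1}=(p+q)^{-1}\bigl(\zeta^k i(\partial/\partial z^k)+\bar\zeta^l i(\partial/\partial\bar z^l)\bigr)$ if $p+q>0$ and $\delta^{-1}=0$ if $p+q=0$. Let $r\in\mathcal W\otimes\Lambda^1$ contain only non-negative powers of $\nu$ and satisfy $\delta^{-1}r=0$ and $\delta r=R+\nabla r+\frac1\nu\, r\circ r$. Put $\gamma=-\vartheta+r$ and let $\hat D=\hat\nabla+\frac1\nu\hat\gamma$, a connection on $\mathbf V$. Then $\hat D$ has scalar curvature: $$\hat D^2=i\omega,\qquad \omega=\tfrac1\nu\,\omega_{-1},$$ as operators on $\mathbf V$-valued differential forms over every holomorphic coordinate chart of $M$. -/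

import Mathlib

open scoped TensorProduct ContDiff Manifold

set_option linter.unusedSectionVars false

noncomputable section

namespace FockBundle

/-! ## Formal Wick algebra over a commutative coefficient algebra

The coefficient algebra `A` is the algebra of smooth functions on a coordinate chart, or `ℂ` for a
single fibre. -/

/-- Formal Laurent series in `ν` (with finite principal part) over a commutative ring. -/
abbrev Laurent (P : Type) [CommRing P] : Type := LaurentSeries P

/-- The coefficientwise `ℂ`-algebra structure on Laurent series (declared here so that it takes
precedence over the propositionally equal one which passes through power series). -/
instance laurentAlgebra (P : Type) [CommRing P] [Algebra ℂ P] : Algebra ℂ (Laurent P) :=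
  HahnSeries.instAlgebra

/-- Indices of the coordinates: `Sum.inl k` stands for the holomorphic coordinate number `k`
(so for `z^k`, `ζ^k`, `dz^k`), and `Sum.inr l` for the antiholomorphic coordinate number `l`
(so for the conjugates of these). -/
abbrev Idx (n : ℕ) : Type := Fin n ⊕ Fin n

/-- Formal power series in the fibre variables `ζ^k` and their conjugates, coefficients in `A`. -/
abbrev Fib (A : Type) [CommRing A] (n : ℕ) : Type := MvPowerSeries (Idx n) A

/-- Formal Laurent series in `ν` (finite principal part) whose coefficients are formal power
series in the fibre variables. -/
abbrev Wick (A : Type) [CommRing A] (n : ℕ) : Type := Laurent (Fib A n)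

/-- The exterior algebra on the symbols `dz^k`, `dz̄^l`. -/
abbrev Ext (n : ℕ) : Type := ExteriorAlgebra ℂ (Idx n → ℂ)

/-- Wick-algebra valued differential forms: in a chart every differential form is a combination
of the constant forms with function coefficients. -/
abbrev WickForms (A : Type) [CommRing A] [Algebra ℂ A] (n : ℕ) : Type := Wick A n ⊗[ℂ] Ext n

section Algebra

/-- Apply a linear map to every coefficient of a Laurent series in `ν`. -/
def liftNu {P Q : Type} [CommRing P] [Algebra ℂ P] [CommRing Q] [Algebra ℂ Q]
    (φ : P →ₗ[ℂ] Q) : Laurent P →ₗ[ℂ] Laurent Q where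
  toFun w := w.map φ
  map_add' x y := by ext; simp
  map_smul' c x := by ext; simp

/-- Apply a linear map to every coefficient of a power series in the fibre variables. -/
def coeffwise {A B : Type} [CommRing A] [Algebra ℂ A] [CommRing B] [Algebra ℂ B] (n : ℕ)
    (φ : A →ₗ[ℂ] B) : Fib A n →ₗ[ℂ] Fib B n where
  toFun f := fun α => φ (f α)
  map_add' x y := by funext α; exact map_add φ _ _
  map_smul' c x := by funext α; exact map_smul φ _ _

variable {A : Type} [CommRing A] [Algebra ℂ A] {n : ℕ}

/-- The element of the Wick algebra given by a function of the base point only. -/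
def ofFn (n : ℕ) (a : A) : Wick A n := HahnSeries.C (MvPowerSeries.C a)

/-- The fibre variables `ζ^k = fibVar (inl k)` and their conjugates `fibVar (inr l)`. -/
def fibVar (A : Type) [CommRing A] {n : ℕ} (i : Idx n) : Wick A n :=
  HahnSeries.C (MvPowerSeries.X i)

/-- The power `ν ^ N` of the formal parameter. -/
def nuPow (A : Type) [CommRing A] (n : ℕ) (N : ℤ) : Wick A n := HahnSeries.single N 1

/-- The derivative with respect to a fibre variable. -/
def fibDeriv (A : Type) [CommRing A] [Algebra ℂ A] {n : ℕ} (i : Idx n) :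
    Wick A n →ₗ[ℂ] Wick A n :=
  liftNu ((MvPowerSeries.pderiv A i).toLinearMap.restrictScalars ℂ)

/-- Pointwise (commutative) multiplication by an element of the Wick algebra. -/
def mulBy (w : Wick A n) : Wick A n →ₗ[ℂ] Wick A n := LinearMap.mulLeft ℂ w

/-- An operator on functions of the base point, applied to all coefficients. -/
def baseOp (n : ℕ) (φ : A →ₗ[ℂ] A) : Wick A n →ₗ[ℂ] Wick A n := liftNu (coeffwise n φ)

/-- The basic 1-forms `dz^k = dx (inl k)` and `dz̄^l = dx (inr l)`. -/
def dx {n : ℕ} (i : Idx n) : Ext n := ExteriorAlgebra.ι ℂ (Pi.single i 1)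

/-- Left exterior multiplication by a basic 1-form. -/
def wedge {n : ℕ} (i : Idx n) : Ext n →ₗ[ℂ] Ext n := LinearMap.mulLeft ℂ (dx i)

/-! ### The Wick product -/

/-- The bidifferential operator of order `r` in the Wick product, without the factor `ν^r / r!`:
`g^{l₁k₁} ⋯ g^{l_r k_r} (∂^r f / ∂ζ̄^{l₁} ⋯ ∂ζ̄^{l_r}) (∂^r h / ∂ζ^{k₁} ⋯ ∂ζ^{k_r})`,
where `(g^{lk})` is the inverse of the matrix `(g_{kl})`. -/
def wickTerm (g : Matrix (Fin n) (Fin n) A) : ℕ → Wick A n →ₗ[ℂ] Wick A n →ₗ[ℂ] Wick A n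
  | 0 => LinearMap.mul ℂ (Wick A n)
  | r + 1 => ∑ l, ∑ k, ((wickTerm g r).compl₁₂ (fibDeriv A (Sum.inr l))
      (fibDeriv A (Sum.inl k))).compr₂ (mulBy (ofFn n (g⁻¹ l k)))

theorem exists_bound (f : Wick A n) : ∃ a : ℤ, ∀ m < a, f.coeff m = 0 :=
  ⟨f.order, fun _ hm => HahnSeries.coeff_eq_zero_of_lt_order hm⟩

theorem mul_bound {f h : Wick A n} {a b : ℤ} (hf : ∀ m < a, f.coeff m = 0)
    (hh : ∀ m < b, h.coeff m = 0) : ∀ m < a + b, (f * h).coeff m = 0 := by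
  intro m hm
  rw [HahnSeries.coeff_mul]
  refine Finset.sum_eq_zero fun p hp => ?_
  have hp' := (Finset.mem_antidiagonal.1 hp).2.2
  by_cases h1 : p.1 < a
  · rw [hf _ h1, zero_mul]
  · rw [hh p.2 (by omega), mul_zero]

theorem liftNu_bound {P : Type} [CommRing P] [Algebra ℂ P] (φ : P →ₗ[ℂ] P)
    {f : Laurent P} {a : ℤ} (hf : ∀ m < a, f.coeff m = 0) :
    ∀ m < a, (liftNu φ f).coeff m = 0 := by
  intro m hm
  simp [liftNu, hf m hm]

theorem wickTerm_bound (g : Matrix (Fin n) (Fin n) A) (r : ℕ) : ∀ {f h : Wick A n} {a b : ℤ},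
    (∀ m < a, f.coeff m = 0) → (∀ m < b, h.coeff m = 0) →
    ∀ m < a + b, (wickTerm g r f h).coeff m = 0 := by
  induction r with
  | zero => intro f h a b hf hh; exact mul_bound hf hh
  | succ r ih =>
    intro f h a b hf hh m hm
    simp only [wickTerm, LinearMap.sum_apply, HahnSeries.coeff_sum]
    refine Finset.sum_eq_zero fun l _ => Finset.sum_eq_zero fun k _ => ?_
    have key := ih (liftNu_bound ((MvPowerSeries.pderiv A
      (Sum.inr l : Idx n)).toLinearMap.restrictScalars ℂ) hf)
      (liftNu_bound ((MvPowerSeries.pderiv A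
      (Sum.inl k : Idx n)).toLinearMap.restrictScalars ℂ) hh)
    have hc : ∀ m < (0 : ℤ), (ofFn n (g⁻¹ l k)).coeff m = 0 := fun m hm =>
      HahnSeries.coeff_single_of_ne (ne_of_lt hm)
    exact mul_bound hc key m (by omega)

/-- The coefficient of `ν^N` in `∑_r (ν^r / r!) wickTerm r f h`. -/
def wickCoeff (g : Matrix (Fin n) (Fin n) A) (f h : Wick A n) (N : ℤ) : Fib A n :=
  ∑ᶠ r : ℕ, ((r.factorial : ℂ)⁻¹) • (wickTerm g r f h).coeff (N - r)

theorem wickCoeff_finite (g : Matrix (Fin n) (Fin n) A) (f h : Wick A n) (N : ℤ) :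
    (Function.support fun r : ℕ =>
      ((r.factorial : ℂ)⁻¹) • (wickTerm g r f h).coeff (N - r)).Finite := by
  obtain ⟨a, ha⟩ := exists_bound f
  obtain ⟨b, hb⟩ := exists_bound h
  refine (Set.finite_Iic (N - (a + b)).toNat).subset fun r hr => ?_
  by_contra hlt
  simp only [Set.mem_Iic, not_le] at hlt
  exact hr (by simp only [wickTerm_bound g r ha hb (N - r) (by omega), smul_zero])

theorem wickCoeff_bound (g : Matrix (Fin n) (Fin n) A) (f h : Wick A n) :
    BddBelow (Function.support (wickCoeff g f h)) := by
  obtain ⟨a, ha⟩ := exists_bound f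
  obtain ⟨b, hb⟩ := exists_bound h
  refine ⟨a + b, fun N hN => ?_⟩
  by_contra hlt
  refine hN (finsum_eq_zero_of_forall_eq_zero fun r => ?_)
  rw [wickTerm_bound g r ha hb (N - r) (by omega), smul_zero]

/-- The Wick product `f ∘ h = ∑_r (ν^r / r!) g^{l₁k₁} ⋯ g^{l_r k_r} ∂^r f/∂ζ̄^{l₁}⋯∂ζ̄^{l_r}
∂^r h/∂ζ^{k₁}⋯∂ζ^{k_r}`. -/
def wick (g : Matrix (Fin n) (Fin n) A) : Wick A n →ₗ[ℂ] Wick A n →ₗ[ℂ] Wick A n :=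
  LinearMap.mk₂ ℂ
    (fun f h => HahnSeries.ofSuppBddBelow (wickCoeff g f h) (wickCoeff_bound g f h))
    (fun f f' h => by
      ext1; funext N
      simp only [HahnSeries.coeff_ofSuppBddBelow, HahnSeries.coeff_add, wickCoeff,
        map_add, LinearMap.add_apply, smul_add]
      exact finsum_add_distrib (wickCoeff_finite g f h N) (wickCoeff_finite g f' h N))
    (fun c f h => by
      ext1; funext N
      simp only [HahnSeries.coeff_ofSuppBddBelow, HahnSeries.coeff_smul, wickCoeff,
        map_smul, LinearMap.smul_apply]
      rw [smul_finsum' c (wickCoeff_finite g f h N)]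
      exact finsum_congr fun r => smul_comm _ _ _)
    (fun f h h' => by
      ext1; funext N
      simp only [HahnSeries.coeff_ofSuppBddBelow, HahnSeries.coeff_add, wickCoeff,
        map_add, smul_add]
      exact finsum_add_distrib (wickCoeff_finite g f h N) (wickCoeff_finite g f h' N))
    (fun c f h => by
      ext1; funext N
      simp only [HahnSeries.coeff_ofSuppBddBelow, HahnSeries.coeff_smul, wickCoeff,
        map_smul]
      rw [smul_finsum' c (wickCoeff_finite g f h N)]
      exact finsum_congr fun r => smul_comm _ _ _)

/-- The product on Wick-algebra valued forms: Wick product in the first factor, wedge product in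
the second. -/
def circ (g : Matrix (Fin n) (Fin n) A) :
    WickForms A n →ₗ[ℂ] WickForms A n →ₗ[ℂ] WickForms A n :=
  TensorProduct.map₂ (wick g) (LinearMap.mul ℂ (Ext n))

/-! ### The formal Fock space -/

/-- The projection `Π' w = w|_{ζ̄ = 0}` on power series in the fibre variables. -/
def projFib (A : Type) [CommRing A] [Algebra ℂ A] (n : ℕ) : Fib A n →ₗ[ℂ] Fib A n where
  toFun f := by
    classical
    exact fun α => if ∀ l, α (Sum.inr l) = 0 then f α else 0
  map_add' x y := by
    classical
    funext α
    change (if _ then x α + y α else 0) = (if _ then x α else 0) + (if _ then y α else 0)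
    split_ifs <;> simp
  map_smul' c x := by
    classical
    funext α
    change (if _ then c • x α else 0) = c • (if _ then x α else 0)
    split_ifs <;> simp

/-- The projection `Π'` on the Wick algebra. -/
def projV (A : Type) [CommRing A] [Algebra ℂ A] (n : ℕ) : Wick A n →ₗ[ℂ] Wick A n :=
  liftNu (projFib A n)

/-- The formal Fock space: the series of the Wick algebra that do not contain any of the
antiholomorphic fibre variables. -/
def Fock (A : Type) [CommRing A] [Algebra ℂ A] (n : ℕ) : Submodule ℂ (Wick A n) where
  carrier := {w | ∀ (N : ℤ) (α : Idx n →₀ ℕ), (∃ l, α (Sum.inr l) ≠ 0) →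
    MvPowerSeries.coeff α (w.coeff N) = 0}
  zero_mem' := fun N α _ => by simp
  add_mem' := fun {x y} hx hy N α h => by
    rw [HahnSeries.coeff_add, map_add, hx N α h, hy N α h, add_zero]
  smul_mem' := fun c x hx N α h => by
    have h0 : (x.coeff N) α = 0 := hx N α h
    change c • ((x.coeff N) α) = 0
    rw [h0, smul_zero]

theorem projV_mem (w : Wick A n) : projV A n w ∈ Fock A n := by
  classical
  rintro N α ⟨l, hl⟩
  change (if ∀ l, α (Sum.inr l) = 0 then (w.coeff N) α else 0) = 0
  exact if_neg fun h => hl (h l)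

theorem fock_fib_mul {f h : Fib A n}
    (hf : ∀ α : Idx n →₀ ℕ, (∃ l, α (Sum.inr l) ≠ 0) → MvPowerSeries.coeff α f = 0)
    (hh : ∀ α : Idx n →₀ ℕ, (∃ l, α (Sum.inr l) ≠ 0) → MvPowerSeries.coeff α h = 0)
    (α : Idx n →₀ ℕ) (hα : ∃ l, α (Sum.inr l) ≠ 0) : MvPowerSeries.coeff α (f * h) = 0 := by
  classical
  rw [MvPowerSeries.coeff_mul]
  obtain ⟨l, hl⟩ := hα
  refine Finset.sum_eq_zero fun p hp => ?_
  have hp' : p.1 + p.2 = α := Finset.HasAntidiagonal.mem_antidiagonal.1 hp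
  by_cases h1 : p.1 (Sum.inr l) = 0
  · rw [hh p.2 ⟨l, fun h2 => hl (by rw [← hp', Finsupp.add_apply, h1, h2])⟩, mul_zero]
  · rw [hf p.1 ⟨l, h1⟩, zero_mul]

theorem fock_mul {w v : Wick A n} (hw : w ∈ Fock A n) (hv : v ∈ Fock A n) :
    w * v ∈ Fock A n := by
  intro N α hα
  rw [HahnSeries.coeff_mul, map_sum]
  exact Finset.sum_eq_zero fun p _ => fock_fib_mul (hw p.1) (hv p.2) α hα

theorem fock_single (N : ℤ) {f : Fib A n}
    (hf : ∀ α : Idx n →₀ ℕ, (∃ l, α (Sum.inr l) ≠ 0) → MvPowerSeries.coeff α f = 0) :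
    (HahnSeries.single N f : Wick A n) ∈ Fock A n := by
  intro N' α hα
  by_cases h : N' = N
  · subst h
    rw [HahnSeries.coeff_single_same]
    exact hf α hα
  · rw [HahnSeries.coeff_single_of_ne h, map_zero]

theorem fock_C_coeff (a : A) (α : Idx n →₀ ℕ) (hα : ∃ l, α (Sum.inr l) ≠ 0) :
    MvPowerSeries.coeff α (MvPowerSeries.C a : Fib A n) = 0 := by
  classical
  obtain ⟨l, hl⟩ := hα
  rw [MvPowerSeries.coeff_C, if_neg]
  rintro rfl
  exact hl rfl

theorem fock_fibVar (k : Fin n) : fibVar A (Sum.inl k : Idx n) ∈ Fock A n := by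
  classical
  refine fock_single 0 ?_
  rintro α ⟨l, hl⟩
  rw [MvPowerSeries.coeff_X, if_neg]
  rintro rfl
  exact hl (by simp)

theorem fock_ofFn (a : A) : ofFn n a ∈ Fock A n := fock_single 0 (fock_C_coeff a)

theorem fock_fibDeriv (i : Idx n) {v : Wick A n} (hv : v ∈ Fock A n) :
    fibDeriv A i v ∈ Fock A n := by
  rintro N α ⟨l, hl⟩
  change MvPowerSeries.coeff α (MvPowerSeries.pderiv A i (v.coeff N)) = 0
  rw [MvPowerSeries.coeff_pderiv, hv N _ ⟨l, ?_⟩, zero_mul]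
  rw [Finsupp.add_apply]
  omega

theorem fock_baseOp (φ : A →ₗ[ℂ] A) {v : Wick A n} (hv : v ∈ Fock A n) :
    baseOp n φ v ∈ Fock A n := by
  intro N α hα
  have h0 : (v.coeff N) α = 0 := hv N α hα
  change φ ((v.coeff N) α) = 0
  rw [h0, map_zero]

/-- Fock-space valued differential forms. -/
abbrev FockForms (A : Type) [CommRing A] [Algebra ℂ A] (n : ℕ) : Type := Fock A n ⊗[ℂ] Ext n

/-- The action `ŵ v = Π'(w ∘ v)` of the Wick algebra on the Fock space. -/
def hatFib (g : Matrix (Fin n) (Fin n) A) : Wick A n →ₗ[ℂ] Fock A n →ₗ[ℂ] Fock A n :=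
  (wick g).compl₁₂ LinearMap.id (Fock A n).subtype |>.compr₂
    ((projV A n).codRestrict (Fock A n) projV_mem)

/-- The action `w ↦ ŵ` of Wick-algebra valued forms on Fock-space valued forms. -/
def hat (g : Matrix (Fin n) (Fin n) A) :
    WickForms A n →ₗ[ℂ] FockForms A n →ₗ[ℂ] FockForms A n :=
  TensorProduct.map₂ (hatFib g) (LinearMap.mul ℂ (Ext n))

/-! ### Formal scalar forms acting on Fock-space valued forms -/

/-- A formal function `∑_N ν^N f_N`, viewed in the Wick algebra. -/
def ofFormalFn (n : ℕ) : Laurent A →ₗ[ℂ] Wick A n :=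
  liftNu
    { toFun := fun a => (MvPowerSeries.C a : Fib A n)
      map_add' := fun a b => map_add _ a b
      map_smul' := fun c a => by
        rw [RingHom.id_apply, Algebra.smul_def, map_mul, Algebra.smul_def,
          MvPowerSeries.algebraMap_apply] }

theorem fock_ofFormalFn (f : Laurent A) : ofFormalFn n f ∈ Fock A n :=
  fun N α hα => fock_C_coeff (f.coeff N) α hα

/-- Pointwise multiplication of elements of the Fock space by formal functions. -/
def scalarMulFib (A : Type) [CommRing A] [Algebra ℂ A] (n : ℕ) :
    Laurent A →ₗ[ℂ] Fock A n →ₗ[ℂ] Fock A n :=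
  LinearMap.mk₂ ℂ
    (fun f v => ⟨ofFormalFn n f * v, fock_mul (fock_ofFormalFn f) v.2⟩)
    (fun f f' v => by
      apply Subtype.ext
      simp only [map_add, add_mul, Submodule.coe_add])
    (fun c f v => by
      apply Subtype.ext
      simp only [map_smul, smul_mul_assoc, Submodule.coe_smul])
    (fun f v v' => by
      apply Subtype.ext
      simp only [mul_add, Submodule.coe_add])
    (fun c f v => by
      apply Subtype.ext
      simp only [mul_smul_comm, Submodule.coe_smul])

/-- Formal scalar differential forms. -/
abbrev ScalarForms (A : Type) [CommRing A] [Algebra ℂ A] (n : ℕ) : Type :=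
  Laurent A ⊗[ℂ] Ext n

/-- Left multiplication of Fock-space valued forms by formal scalar forms. -/
def scalarMul (A : Type) [CommRing A] [Algebra ℂ A] (n : ℕ) :
    ScalarForms A n →ₗ[ℂ] FockForms A n →ₗ[ℂ] FockForms A n :=
  TensorProduct.map₂ (scalarMulFib A n) (LinearMap.mul ℂ (Ext n))

/-- Multiplication of Fock-space valued forms by `1/ν`. -/
def nuInvFock (A : Type) [CommRing A] [Algebra ℂ A] (n : ℕ) :
    FockForms A n →ₗ[ℂ] FockForms A n :=
  scalarMul A n (HahnSeries.single (-1) 1 ⊗ₜ 1)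

/-- Multiplication of Wick-algebra valued forms by `1/ν`. -/
def nuInvWick (A : Type) [CommRing A] [Algebra ℂ A] (n : ℕ) :
    WickForms A n →ₗ[ℂ] WickForms A n :=
  TensorProduct.map (mulBy (nuPow A n (-1))) LinearMap.id

/-! ### Connections, curvature and Fedosov's operators in local coordinates

`d (inl k)` and `d (inr l)` are the operators `∂/∂z^k` and `∂/∂z̄^l` on functions, and
`g k l` are the components `g_{kl}` of the metric. -/

variable (d : Idx n → A →ₗ[ℂ] A) (g : Matrix (Fin n) (Fin n) A)

/-- Christoffel symbols `Γ^s_{ki} = g^{ls} ∂g_{kl}/∂z^i`. -/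
def christoffel (s k i : Fin n) : A := ∑ l, g⁻¹ l s * d (Sum.inl i) (g k l)

/-- Antiholomorphic Christoffel symbols `Γ^t_{lj} = g^{tk} ∂g_{kl}/∂z̄^j`
(with `t`, `l`, `j` antiholomorphic indices and `k` a holomorphic one). -/
def christoffelBar (t l j : Fin n) : A := ∑ k, g⁻¹ t k * d (Sum.inr j) (g k l)

/-- `∂/∂z^k - Γ^s_{ki} ζ^i ∂/∂ζ^s` on the Wick algebra. -/
def nablaHol (k : Fin n) : Wick A n →ₗ[ℂ] Wick A n :=
  baseOp n (d (Sum.inl k)) - ∑ s, ∑ i,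
    mulBy (ofFn n (christoffel d g s k i) * fibVar A (Sum.inl i)) ∘ₗ fibDeriv A (Sum.inl s)

/-- `∂/∂z̄^l - Γ^t_{lj} ζ̄^j ∂/∂ζ̄^t` on the Wick algebra. -/
def nablaBar (l : Fin n) : Wick A n →ₗ[ℂ] Wick A n :=
  baseOp n (d (Sum.inr l)) - ∑ t, ∑ j,
    mulBy (ofFn n (christoffelBar d g t l j) * fibVar A (Sum.inr j)) ∘ₗ fibDeriv A (Sum.inr t)

/-- The Kähler connection `∇` on Wick-algebra valued forms. -/
def nabla : WickForms A n →ₗ[ℂ] WickForms A n :=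
  ∑ k, TensorProduct.map (nablaHol d g k) (wedge (Sum.inl k)) +
  ∑ l, TensorProduct.map (nablaBar d g l) (wedge (Sum.inr l))

theorem fock_nablaHol (k : Fin n) : ∀ v ∈ Fock A n, nablaHol d g k v ∈ Fock A n := by
  intro v hv
  simp only [nablaHol, LinearMap.sub_apply, LinearMap.sum_apply, LinearMap.comp_apply]
  refine Submodule.sub_mem _ (fock_baseOp _ hv) (Submodule.sum_mem _ fun s _ =>
    Submodule.sum_mem _ fun i _ => ?_)
  exact fock_mul (fock_mul (fock_ofFn _) (fock_fibVar i)) (fock_fibDeriv _ hv)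

/-- The Kähler connection on Fock-space valued forms,
`∇̂ = d - Γ^s_{ki} ζ^i (∂/∂ζ^s) dz^k`. -/
def nablaHat : FockForms A n →ₗ[ℂ] FockForms A n :=
  ∑ k, TensorProduct.map ((nablaHol d g k).restrict (fock_nablaHol d g k))
      (wedge (Sum.inl k)) +
  ∑ l, TensorProduct.map
      ((baseOp n (d (Sum.inr l))).restrict fun _ hv => fock_baseOp (d (Sum.inr l)) hv)
      (wedge (Sum.inr l))

/-- `R = (-g^{ts} ∂g_{kt} ∧ ∂̄g_{sl} + ∂∂̄g_{kl}) ζ^k ζ̄^l`. -/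
def curvR : WickForms A n :=
  ∑ k, ∑ l, ∑ p, ∑ q,
    (ofFn n (-(∑ t, ∑ s, g⁻¹ t s * d (Sum.inl p) (g k t) * d (Sum.inr q) (g s l)) +
        d (Sum.inl p) (d (Sum.inr q) (g k l))) *
      fibVar A (Sum.inl k) * fibVar A (Sum.inr l)) ⊗ₜ (dx (Sum.inl p) * dx (Sum.inr q))

/-- `δ = (∂/∂ζ^k) dz^k + (∂/∂ζ̄^l) dz̄^l`. -/
def delta (A : Type) [CommRing A] [Algebra ℂ A] (n : ℕ) : WickForms A n →ₗ[ℂ] WickForms A n :=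
  ∑ i : Idx n, TensorProduct.map (fibDeriv A i) (wedge i)

/-- Division of the component of degree `p` in the fibre variables by `p + q`
(by convention the result is `0` if `p + q = 0`). -/
def divDeg (A : Type) [CommRing A] [Algebra ℂ A] (n q : ℕ) : Wick A n →ₗ[ℂ] Wick A n :=
  liftNu
    { toFun := fun f α => ((α.degree + q : ℕ) : ℂ)⁻¹ • f α
      map_add' := fun f h => by funext α; exact smul_add _ _ _
      map_smul' := fun c f => by funext α; exact smul_comm _ _ _ }

/-- The operator `δ⁻¹`: on forms of degree `q` that are homogeneous of degree `p` in the fibre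
variables it is `(p + q)⁻¹ (ζ^k i(∂/∂z^k) + ζ̄^l i(∂/∂z̄^l))`, and `0` if `p + q = 0`. -/
def deltaInv (A : Type) [CommRing A] [Algebra ℂ A] (n : ℕ) :
    WickForms A n →ₗ[ℂ] WickForms A n :=
  (∑ i : Idx n, TensorProduct.map (mulBy (fibVar A i))
    (CliffordAlgebra.contractLeft (Q := (0 : QuadraticForm ℂ (Idx n → ℂ)))
      (LinearMap.proj i))) ∘ₗ
  ∑ q ∈ Finset.range (2 * n + 1), TensorProduct.map (divDeg A n q)
    (GradedAlgebra.proj (fun j : ℕ => ⋀[ℂ]^j (Idx n → ℂ)) q)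

/-- `ϑ = g_{kl} ζ̄^l dz^k - g_{kl} ζ^k dz̄^l`. -/
def theta : WickForms A n :=
  ∑ k, ∑ l, ((ofFn n (g k l) * fibVar A (Sum.inr l)) ⊗ₜ dx (Sum.inl k) -
    (ofFn n (g k l) * fibVar A (Sum.inl k)) ⊗ₜ dx (Sum.inr l))

/-- `γ = -ϑ + r`. -/
def gamma (r : WickForms A n) : WickForms A n := -theta g + r

/-- The connection `D̂ = ∇̂ + (1/ν) γ̂` on the Fock bundle. -/
def dHat (r : WickForms A n) : Module.End ℂ (FockForms A n) :=
  nablaHat d g + nuInvFock A n ∘ₗ hat g (gamma g r)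

/-- The Kähler form `ω₋₁ = i g_{kl} dz^k ∧ dz̄^l`. -/
def kahlerForm : A ⊗[ℂ] Ext n :=
  ∑ k, ∑ l, (Complex.I • g k l) ⊗ₜ (dx (Sum.inl k) * dx (Sum.inr l))

/-- The formal form `ω = (1/ν) ω₋₁`. -/
def omegaForm : ScalarForms A n :=
  TensorProduct.map (HahnSeries.single.linearMap (R := ℂ) (-1)) LinearMap.id (kahlerForm g)

/-- Wick-algebra valued forms of degree `q`. -/
def formsOfDegree (A : Type) [CommRing A] [Algebra ℂ A] (n q : ℕ) :
    Submodule ℂ (WickForms A n) :=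
  LinearMap.range (TensorProduct.map (LinearMap.id : Wick A n →ₗ[ℂ] Wick A n)
    (⋀[ℂ]^q (Idx n → ℂ)).subtype)

/-- Elements of the Wick algebra that contain only non-negative powers of `ν`. -/
def nonnegNu (A : Type) [CommRing A] [Algebra ℂ A] (n : ℕ) : Submodule ℂ (Wick A n) where
  carrier := {w | ∀ N < 0, w.coeff N = 0}
  zero_mem' := fun N _ => rfl
  add_mem' := fun {x y} hx hy N h => by
    rw [HahnSeries.coeff_add, hx N h, hy N h, add_zero]
  smul_mem' := fun c x hx N h => by rw [HahnSeries.coeff_smul, hx N h, smul_zero]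

/-- Wick-algebra valued forms that contain only non-negative powers of `ν`. -/
def nonnegNuForms (A : Type) [CommRing A] [Algebra ℂ A] (n : ℕ) : Submodule ℂ (WickForms A n) :=
  LinearMap.range (TensorProduct.map (nonnegNu A n).subtype
    (LinearMap.id : Ext n →ₗ[ℂ] Ext n))

end Algebra

/-! ## Smooth functions on open subsets of `ℂ^n` and Wirtinger derivatives -/

section Smooth

variable {n : ℕ}

/-- Extension by zero of a function on an open subset. -/
def extendZero (O : TopologicalSpace.Opens (Fin n → ℂ)) (f : O → ℂ) : (Fin n → ℂ) → ℂ :=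
  Function.extend Subtype.val f 0

theorem extendZero_apply {O : TopologicalSpace.Opens (Fin n → ℂ)} (f : O → ℂ)
    {z : Fin n → ℂ} (hz : z ∈ O) : extendZero O f z = f ⟨z, hz⟩ :=
  Subtype.val_injective.extend_apply f 0 ⟨z, hz⟩

/-- The algebra of complex-valued functions on `O` that are smooth in the real sense. -/
def SmoothFn (O : TopologicalSpace.Opens (Fin n → ℂ)) : Subalgebra ℂ (O → ℂ) where
  carrier := {f | ContDiffOn ℝ ∞ (extendZero O f) (O : Set (Fin n → ℂ))}
  mul_mem' := fun {f h} hf hh => by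
    refine (ContDiffOn.mul hf hh).congr fun z hz => ?_
    simp [extendZero_apply _ hz]
  add_mem' := fun {f h} hf hh => by
    refine (ContDiffOn.add hf hh).congr fun z hz => ?_
    simp [extendZero_apply _ hz]
  algebraMap_mem' := fun c => by
    refine (contDiffOn_const (c := c)).congr fun z hz => ?_
    simp [extendZero_apply _ hz]

theorem smoothFn_differentiableAt {O : TopologicalSpace.Opens (Fin n → ℂ)} (f : SmoothFn O)
    {z : Fin n → ℂ} (hz : z ∈ O) : DifferentiableAt ℝ (extendZero O f.1) z :=
  (f.2.contDiffAt (O.isOpen.mem_nhds hz)).differentiableAt (by simp)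

/-- The derivative of smooth functions along a constant real vector field `v`. -/
def dirDeriv (O : TopologicalSpace.Opens (Fin n → ℂ)) (v : Fin n → ℂ) :
    SmoothFn O →ₗ[ℂ] SmoothFn O where
  toFun f := ⟨fun z => fderiv ℝ (extendZero O f.1) z v, by
    have h1 : ContDiffOn ℝ ∞ (fderiv ℝ (extendZero O f.1)) (O : Set (Fin n → ℂ)) :=
      ContDiffOn.fderiv_of_isOpen f.2 O.isOpen le_rfl
    refine (h1.clm_apply (contDiffOn_const (c := v))).congr fun z hz => ?_
    rw [extendZero_apply _ hz]⟩
  map_add' f h := by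
    apply Subtype.ext
    funext z
    have he : extendZero O (f + h).1 =ᶠ[nhds z.1] extendZero O f.1 + extendZero O h.1 := by
      filter_upwards [O.isOpen.mem_nhds z.2] with y hy
      simp [extendZero_apply _ hy]
    change fderiv ℝ (extendZero O (f + h).1) z v = fderiv ℝ (extendZero O f.1) z v +
      fderiv ℝ (extendZero O h.1) z v
    rw [he.fderiv_eq, fderiv_add (smoothFn_differentiableAt f z.2) (smoothFn_differentiableAt h z.2)]
    rfl
  map_smul' c f := by
    apply Subtype.ext
    funext z
    have he : extendZero O (c • f).1 =ᶠ[nhds z.1] c • extendZero O f.1 := by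
      filter_upwards [O.isOpen.mem_nhds z.2] with y hy
      simp [extendZero_apply _ hy]
    change fderiv ℝ (extendZero O (c • f).1) z v = c • fderiv ℝ (extendZero O f.1) z v
    rw [he.fderiv_eq, fderiv_const_smul (smoothFn_differentiableAt f z.2)]
    rfl

/-- The Wirtinger derivatives `∂/∂z^k = (∂/∂x^k - i ∂/∂y^k)/2` and
`∂/∂z̄^l = (∂/∂x^l + i ∂/∂y^l)/2`. -/
def wirtinger (O : TopologicalSpace.Opens (Fin n → ℂ)) : Idx n → SmoothFn O →ₗ[ℂ] SmoothFn O
  | Sum.inl k => (1 / 2 : ℂ) •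
      (dirDeriv O (Pi.single k 1) - Complex.I • dirDeriv O (Pi.single k Complex.I))
  | Sum.inr l => (1 / 2 : ℂ) •
      (dirDeriv O (Pi.single l 1) + Complex.I • dirDeriv O (Pi.single l Complex.I))

/-- Evaluation of a smooth function at a point. -/
def evalPt (O : TopologicalSpace.Opens (Fin n → ℂ)) (p : O) : SmoothFn O →ₗ[ℂ] ℂ where
  toFun f := f.1 p
  map_add' _ _ := rfl
  map_smul' _ _ := rfl

/-- The value in the fibre over a point of a Wick-algebra valued form on a chart. -/
def evalForm (O : TopologicalSpace.Opens (Fin n → ℂ)) (p : O) :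
    WickForms (SmoothFn O) n →ₗ[ℂ] WickForms ℂ n :=
  TensorProduct.map (liftNu (coeffwise n (evalPt O p))) LinearMap.id

end Smooth

/-! ## Kähler manifolds and global sections -/

section Manifold

/-- The block matrix by which `ζ, ζ̄` (and `dz, dz̄`) change under a change of holomorphic
coordinates with Jacobian matrix `J`. -/
def blockJac {n : ℕ} (J : Matrix (Fin n) (Fin n) ℂ) : Matrix (Idx n) (Idx n) ℂ :=
  Matrix.fromBlocks J 0 0 (J.map (starRingEnd ℂ))

/-- The linear form `∑_j B_{ij} x_j` in the fibre variables. -/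
def linForm {n : ℕ} (B : Matrix (Idx n) (Idx n) ℂ) (i : Idx n) : Fib ℂ n :=
  ∑ j, MvPowerSeries.C (B i j) * MvPowerSeries.X j

theorem hasSubst_linForm {n : ℕ} (B : Matrix (Idx n) (Idx n) ℂ) :
    MvPowerSeries.HasSubst (linForm B) :=
  MvPowerSeries.hasSubst_of_constantCoeff_zero fun i => by simp [linForm]

/-- Linear change of variables in a fibre: a form written in the variables `ζ'^i`, `dx'^i` is
rewritten in `ζ^j`, `dx^j` by `ζ'^i = ∑_j B_{ij} ζ^j` and `dx'^i = ∑_j B_{ij} dx^j`. -/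
def fibreChange {n : ℕ} (B : Matrix (Idx n) (Idx n) ℂ) : WickForms ℂ n →ₗ[ℂ] WickForms ℂ n :=
  TensorProduct.map
    (liftNu (MvPowerSeries.substAlgHom (R := ℂ) (hasSubst_linForm B)).toLinearMap)
    (ExteriorAlgebra.map (Matrix.toLin' B.transpose)).toLinearMap

variable (n : ℕ) (M : Type*) [TopologicalSpace M] [ChartedSpace (Fin n → ℂ) M]

/-- Holomorphic coordinate charts of a complex manifold. -/
abbrev HoloChart : Type _ :=
  {e : OpenPartialHomeomorph M (Fin n → ℂ) //
    e ∈ IsManifold.maximalAtlas 𝓘(ℂ, Fin n → ℂ) ω M}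

variable {n M}

/-- The open subset of `ℂ^n` onto which a chart maps. -/
def HoloChart.dom (e : HoloChart n M) : TopologicalSpace.Opens (Fin n → ℂ) :=
  ⟨e.1.target, e.1.open_target⟩

/-- The algebra of smooth functions on a chart, written in the coordinates of the chart. -/
abbrev HoloChart.Fn (e : HoloChart n M) : Type := SmoothFn e.dom

/-- The coordinate vector `∂/∂z^k` at the point with coordinates `z`. -/
def HoloChart.frame (e : HoloChart n M) (z : Fin n → ℂ) (k : Fin n) :
    TangentSpace 𝓘(ℂ, Fin n → ℂ) (e.1.symm z) :=
  mfderiv 𝓘(ℂ, Fin n → ℂ) 𝓘(ℂ, Fin n → ℂ) e.1.symm z (Pi.single k 1 : Fin n → ℂ)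

/-- The Jacobian matrix `∂z'^a/∂z^k` at `x` of the change from the coordinates `z` of `e` to the
coordinates `z'` of `e'`. -/
def HoloChart.jac (e e' : HoloChart n M) (x : M) : Matrix (Fin n) (Fin n) ℂ :=
  Matrix.of fun a k =>
    fderiv ℂ (fun z => e'.1 (e.1.symm z)) (e.1 x) (Pi.single k 1 : Fin n → ℂ) a

variable (n M)

/-- A smooth Hermitian metric: `h x` is a positive definite Hermitian form on the complex tangent
space at `x`, linear in the first and antilinear in the second argument, depending smoothly on
`x`. -/
structure HermitianMetric where
  h : ∀ x : M, TangentSpace 𝓘(ℂ, Fin n → ℂ) x →ₗ[ℂ]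
    TangentSpace 𝓘(ℂ, Fin n → ℂ) x →ₛₗ[starRingEnd ℂ] ℂ
  conj_symm : ∀ x u v, starRingEnd ℂ (h x u v) = h x v u
  pos : ∀ x u, u ≠ 0 → 0 < (h x u u).re
  smooth : ∀ (e : HoloChart n M) (k l : Fin n),
    (fun z : e.dom => h (e.1.symm z) (e.frame z k) (e.frame z l)) ∈ SmoothFn e.dom

variable {n M}

/-- The components `g_{kl}` of a Hermitian metric in a chart. -/
def HermitianMetric.comp (m : HermitianMetric n M) (e : HoloChart n M) :
    Matrix (Fin n) (Fin n) e.Fn :=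
  Matrix.of fun k l =>
    ⟨fun z : e.dom => m.h (e.1.symm z) (e.frame z k) (e.frame z l), m.smooth e k l⟩

variable (n M)

/-- A Kähler metric: a Hermitian metric whose fundamental form `i g_{kl} dz^k ∧ dz̄^l` is closed.
The two conditions are the vanishing of the components of type (2,1) and (1,2) of its exterior
derivative. -/
structure KahlerMetric extends HermitianMetric n M where
  closed_hol : ∀ (e : HoloChart n M) (i k l : Fin n),
    wirtinger e.dom (Sum.inl i) (toHermitianMetric.comp e k l) =
      wirtinger e.dom (Sum.inl k) (toHermitianMetric.comp e i l)
  closed_bar : ∀ (e : HoloChart n M) (j k l : Fin n),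
    wirtinger e.dom (Sum.inr j) (toHermitianMetric.comp e k l) =
      wirtinger e.dom (Sum.inr l) (toHermitianMetric.comp e k j)

/-- A global differential form on `M` with values in the bundle of formal Wick algebras: a family
of local expressions in all holomorphic charts which agree at each point under the change of
coordinates. -/
structure WickSection where
  loc : ∀ e : HoloChart n M, WickForms e.Fn n
  compat : ∀ (e e' : HoloChart n M) (x : M) (hx : x ∈ e.1.source) (hx' : x ∈ e'.1.source),
    evalForm e.dom ⟨e.1 x, e.1.map_source hx⟩ (loc e) =
      fibreChange (blockJac (e.jac e' x))
        (evalForm e'.dom ⟨e'.1 x, e'.1.map_source hx'⟩ (loc e'))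

variable {n M}

/-- The defining conditions of the element `r`: it is a 1-form with values in the bundle of Wick
algebras, contains only non-negative powers of `ν`, and satisfies `δ⁻¹ r = 0` and
`δ r = R + ∇ r + (1/ν) r ∘ r`. -/
structure IsFedosovElement (m : KahlerMetric n M) (r : WickSection n M) : Prop where
  degree_one : ∀ e, r.loc e ∈ formsOfDegree e.Fn n 1
  nonneg_nu : ∀ e, r.loc e ∈ nonnegNuForms e.Fn n
  deltaInv_eq : ∀ e, deltaInv e.Fn n (r.loc e) = 0
  fedosov_eq : ∀ e, delta e.Fn n (r.loc e) =
    curvR (wirtinger e.dom) (m.comp e) + nabla (wirtinger e.dom) (m.comp e) (r.loc e) +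
      nuInvWick e.Fn n (circ (m.comp e) (r.loc e) (r.loc e))

end Manifold

end FockBundle

end

noncomputable section

namespace FockBundle

/-! ## Coefficientwise operators -/

section Coefficientwise

variable {P Q : Type} [CommRing P] [Algebra ℂ P] [CommRing Q] [Algebra ℂ Q]

/-! Write `D̂ = ∑ D̂_i dx^i` with `D̂_i = ∇̂_i + ν⁻¹ γ̂_i`. Since the `dx^i` anticommute, `D̂²`
depends only on the commutators `[D̂_i, D̂_j]`. Four facts reduce these to the Wick algebra.

The map `w ↦ ŵ` is multiplicative (`hatFib_wick`), because the Wick product is associative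
(`wick_assoc`) and the kernel of `Π'` is a left ideal (`projV_wick_projV`). The commutator of `∇̂_i`
with `ŵ` is the action of `∇_i w` (`nablaHatIdx_mul_hatFib`), because the metric is parallel, so
that `∇` is a derivation of the Wick product (`nablaIdx_wick`). The curvature of `∇̂` is `ν⁻¹ R̂`
(`nablaHatIdx_commutator`). Multiplication by `ν⁻¹` is central. Together they show that `D̂²` is
`ν⁻¹` times the action of `R + ∇γ + ν⁻¹ γ ∘ γ`.

Now insert `γ = -ϑ + r`. The form `ϑ` satisfies `∇ϑ = 0` (`nablaIdx_thetaIdx_comm`), and its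
commutator is `ν δ` (`wick_thetaIdx_sub`), so the expression becomes `(R + ∇r - δr + ν⁻¹ r ∘ r) +
ν⁻¹ ϑ ∘ ϑ`. Fedosov's equation for `r` says that the bracket is zero. Finally `ϑ ∘ ϑ = ½ ν δϑ = -ν
g_{kl} dz^k ∧ dz̄^l`, a form without fibre variables, and `-ν⁻¹ g_{kl} dz^k ∧ dz̄^l` is `i ω`.

Infinite sums in `ν` are handled by comparing partial sums modulo high powers of `ν`. Two-forms are
handled through components that need not be antisymmetric, and `twoFormOp_eq_of_add_swap` compares
their antisymmetric parts. -/

@[simp]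
theorem liftNu_coeff (φ : P →ₗ[ℂ] Q) (f : Laurent P) (N : ℤ) :
    (liftNu φ f).coeff N = φ (f.coeff N) := rfl

/-- The defining sum of a product runs over the supports of the factors, which change when an
operator is applied. An interval that depends only on lower bounds serves `f` and its image alike,
so products can be compared term by term. -/
theorem coeff_mul_eq_sum_Icc {f h : Laurent P} {a b : ℤ} (hf : ∀ m < a, f.coeff m = 0)
    (hh : ∀ m < b, h.coeff m = 0) (N : ℤ) :
    (f * h).coeff N = ∑ i ∈ Finset.Icc a (N - b), f.coeff i * h.coeff (N - i) := by
  rw [HahnSeries.coeff_mul]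
  refine Finset.sum_bij_ne_zero (fun p _ _ => p.1) ?_ ?_ ?_ ?_
  · intro p hp hne
    have hp' := (Finset.mem_antidiagonal.1 hp).2.2
    have h1 : ¬ p.1 < a := fun h => hne (by rw [hf _ h, zero_mul])
    have h2 : ¬ p.2 < b := fun h => hne (by rw [hh _ h, mul_zero])
    rw [Finset.mem_Icc]
    omega
  · intro p hp _ q hq _ hpq
    have hp' := (Finset.mem_antidiagonal.1 hp).2.2
    have hq' := (Finset.mem_antidiagonal.1 hq).2.2
    exact Prod.ext hpq (by omega)
  · intro i _ hne
    refine ⟨(i, N - i), ?_, hne, rfl⟩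
    refine Finset.mem_antidiagonal.2 ⟨?_, ?_, by simp⟩
    · exact fun h => hne (by rw [h, zero_mul])
    · exact fun h => hne (by simp only at h; rw [h, mul_zero])
  · intro p hp _
    have hp' := (Finset.mem_antidiagonal.1 hp).2.2
    rw [show N - p.1 = p.2 by omega]

theorem exists_coeff_bound (f : Laurent P) : ∃ a : ℤ, ∀ m < a, f.coeff m = 0 :=
  ⟨f.order, fun _ hm => HahnSeries.coeff_eq_zero_of_lt_order hm⟩

theorem liftNu_coeff_bound (φ : P →ₗ[ℂ] Q) {f : Laurent P} {a : ℤ}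
    (hf : ∀ m < a, f.coeff m = 0) : ∀ m < a, (liftNu φ f).coeff m = 0 := by
  intro m hm
  simp [hf m hm]

theorem liftNu_leibniz {φ : P →ₗ[ℂ] P} (hφ : ∀ x y, φ (x * y) = φ x * y + x * φ y)
    (f h : Laurent P) : liftNu φ (f * h) = liftNu φ f * h + f * liftNu φ h := by
  obtain ⟨a, ha⟩ := exists_coeff_bound f
  obtain ⟨b, hb⟩ := exists_coeff_bound h
  ext N
  rw [HahnSeries.coeff_add, liftNu_coeff, coeff_mul_eq_sum_Icc ha hb,
    coeff_mul_eq_sum_Icc (liftNu_coeff_bound φ ha) hb,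
    coeff_mul_eq_sum_Icc ha (liftNu_coeff_bound φ hb), map_sum, ← Finset.sum_add_distrib]
  simp [hφ]

theorem liftNu_mul {φ : P →ₗ[ℂ] Q} (hφ : ∀ x y, φ (x * y) = φ x * φ y)
    (f h : Laurent P) : liftNu φ (f * h) = liftNu φ f * liftNu φ h := by
  obtain ⟨a, ha⟩ := exists_coeff_bound f
  obtain ⟨b, hb⟩ := exists_coeff_bound h
  ext N
  rw [liftNu_coeff, coeff_mul_eq_sum_Icc ha hb,
    coeff_mul_eq_sum_Icc (liftNu_coeff_bound φ ha) (liftNu_coeff_bound φ hb), map_sum]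
  simp [hφ]

theorem liftNu_C (φ : P →ₗ[ℂ] Q) (x : P) :
    liftNu φ (HahnSeries.C x) = HahnSeries.C (φ x) := by
  ext N
  by_cases h : N = 0
  · subst h; simp
  · simp [HahnSeries.coeff_single_of_ne h]

theorem liftNu_single (φ : P →ₗ[ℂ] Q) (N : ℤ) (x : P) :
    liftNu φ (HahnSeries.single N x) = HahnSeries.single N (φ x) := by
  ext N'
  by_cases h : N' = N
  · subst h; simp
  · simp [HahnSeries.coeff_single_of_ne h]

end Coefficientwise

/-! ### Fibre derivatives, base derivatives and the projection `Π'` -/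

section Operators

variable {A : Type} [CommRing A] [Algebra ℂ A] {n : ℕ}

@[simp]
theorem coeff_coeffwise (φ : A →ₗ[ℂ] A) (f : Fib A n) (α : Idx n →₀ ℕ) :
    MvPowerSeries.coeff α (coeffwise n φ f) = φ (MvPowerSeries.coeff α f) := rfl

theorem coeffwise_leibniz {φ : A →ₗ[ℂ] A} (hφ : ∀ x y, φ (x * y) = φ x * y + x * φ y)
    (f h : Fib A n) : coeffwise n φ (f * h) = coeffwise n φ f * h + f * coeffwise n φ h := by
  classical
  ext α
  rw [map_add, coeff_coeffwise, MvPowerSeries.coeff_mul, MvPowerSeries.coeff_mul,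
    MvPowerSeries.coeff_mul, map_sum, ← Finset.sum_add_distrib]
  simp [hφ]

theorem map_one_of_leibniz {φ : A →ₗ[ℂ] A} (hφ : ∀ x y, φ (x * y) = φ x * y + x * φ y) :
    φ 1 = 0 := by
  have h := hφ 1 1
  simp only [mul_one, one_mul] at h
  exact left_eq_add.1 h

theorem map_mul_natCast (φ : A →ₗ[ℂ] A) (x : A) (k : ℕ) : φ (x * (k : A)) = φ x * k := by
  rw [mul_comm, ← nsmul_eq_mul, map_nsmul, nsmul_eq_mul, mul_comm]

theorem fibDeriv_leibniz (i : Idx n) (f h : Wick A n) :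
    fibDeriv A i (f * h) = fibDeriv A i f * h + f * fibDeriv A i h := by
  refine liftNu_leibniz (fun x y => ?_) f h
  change MvPowerSeries.pderiv A i (x * y) = MvPowerSeries.pderiv A i x * y +
    x * MvPowerSeries.pderiv A i y
  rw [Derivation.leibniz, smul_eq_mul, smul_eq_mul, add_comm, mul_comm y]

theorem baseOp_leibniz {φ : A →ₗ[ℂ] A} (hφ : ∀ x y, φ (x * y) = φ x * y + x * φ y)
    (f h : Wick A n) : baseOp n φ (f * h) = baseOp n φ f * h + f * baseOp n φ h :=
  liftNu_leibniz (coeffwise_leibniz hφ) f h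

theorem fibDeriv_comm (i j : Idx n) (f : Wick A n) :
    fibDeriv A i (fibDeriv A j f) = fibDeriv A j (fibDeriv A i f) := by
  ext N α
  change MvPowerSeries.coeff α (MvPowerSeries.pderiv A i (MvPowerSeries.pderiv A j _)) =
    MvPowerSeries.coeff α (MvPowerSeries.pderiv A j (MvPowerSeries.pderiv A i _))
  simp only [MvPowerSeries.coeff_pderiv]
  by_cases hij : i = j
  · rw [hij]
  · rw [add_right_comm]
    simp [hij, Ne.symm hij]
    ring

theorem baseOp_fibDeriv (φ : A →ₗ[ℂ] A) (i : Idx n) (f : Wick A n) :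
    baseOp n φ (fibDeriv A i f) = fibDeriv A i (baseOp n φ f) := by
  ext N α
  change φ (MvPowerSeries.coeff α (MvPowerSeries.pderiv A i _)) =
    MvPowerSeries.coeff α (MvPowerSeries.pderiv A i (coeffwise n φ _))
  rw [MvPowerSeries.coeff_pderiv, MvPowerSeries.coeff_pderiv, coeff_coeffwise]
  exact_mod_cast map_mul_natCast φ _ _

theorem baseOp_comm {φ ψ : A →ₗ[ℂ] A} (h : ∀ a, φ (ψ a) = ψ (φ a)) (f : Wick A n) :
    baseOp n φ (baseOp n ψ f) = baseOp n ψ (baseOp n φ f) := by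
  ext N α
  exact h _

@[simp]
theorem fibDeriv_ofFn (i : Idx n) (a : A) : fibDeriv A i (ofFn n a) = 0 := by
  rw [fibDeriv, ofFn, liftNu_C]
  change HahnSeries.C (MvPowerSeries.pderiv A i (MvPowerSeries.C a)) = 0
  rw [MvPowerSeries.pderiv_C, map_zero]

theorem fibDeriv_ofFn_mul (i : Idx n) (a : A) (f : Wick A n) :
    fibDeriv A i (ofFn n a * f) = ofFn n a * fibDeriv A i f := by
  rw [fibDeriv_leibniz, fibDeriv_ofFn, zero_mul, zero_add]

theorem fibDeriv_fibVar (i j : Idx n) :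
    fibDeriv A i (fibVar A j) = if i = j then 1 else 0 := by
  rw [fibDeriv, fibVar, liftNu_C]
  change HahnSeries.C (MvPowerSeries.pderiv A i (MvPowerSeries.X j)) = _
  classical
  split_ifs with h
  · subst h
    rw [MvPowerSeries.pderiv_X_self, map_one]
  · rw [MvPowerSeries.pderiv_X_of_ne (Ne.symm h), map_zero]

@[simp]
theorem fibDeriv_fibVar_inl_inl (k l : Fin n) :
    fibDeriv A (Sum.inl k) (fibVar A (Sum.inl l)) = if k = l then 1 else 0 := by
  simp [fibDeriv_fibVar]

@[simp]
theorem fibDeriv_fibVar_inr_inr (k l : Fin n) :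
    fibDeriv A (Sum.inr k) (fibVar A (Sum.inr l)) = if k = l then 1 else 0 := by
  simp [fibDeriv_fibVar]

@[simp]
theorem fibDeriv_fibVar_inl_inr (k l : Fin n) :
    fibDeriv A (Sum.inl k) (fibVar A (Sum.inr l)) = 0 := by
  simp [fibDeriv_fibVar]

@[simp]
theorem fibDeriv_fibVar_inr_inl (k l : Fin n) :
    fibDeriv A (Sum.inr k) (fibVar A (Sum.inl l)) = 0 := by
  simp [fibDeriv_fibVar]

theorem baseOp_ofFn {φ : A →ₗ[ℂ] A} (a : A) : baseOp n φ (ofFn n a) = ofFn n (φ a) := by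
  classical
  rw [baseOp, ofFn, liftNu_C, ofFn]
  congr 1
  ext α
  rw [coeff_coeffwise, MvPowerSeries.coeff_C, MvPowerSeries.coeff_C]
  split_ifs <;> simp

theorem baseOp_fibVar {φ : A →ₗ[ℂ] A} (hφ : ∀ x y, φ (x * y) = φ x * y + x * φ y)
    (i : Idx n) : baseOp n φ (fibVar A i) = 0 := by
  classical
  rw [baseOp, fibVar, liftNu_C]
  convert map_zero (HahnSeries.C (Γ := ℤ) (R := Fib A n))
  ext α
  rw [coeff_coeffwise, MvPowerSeries.coeff_X, map_zero]
  split_ifs <;> simp [map_one_of_leibniz hφ]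

/-- Functions of the base point form a subring of the Wick algebra. -/
def ofFnHom (A : Type) [CommRing A] (n : ℕ) : A →+* Wick A n :=
  (HahnSeries.C : Fib A n →+* Wick A n).comp MvPowerSeries.C

theorem ofFn_mul (a b : A) : ofFn n (a * b) = ofFn n a * ofFn n b := map_mul (ofFnHom A n) a b

theorem ofFn_add (a b : A) : ofFn n (a + b) = ofFn n a + ofFn n b := map_add (ofFnHom A n) a b

theorem ofFn_neg (a : A) : ofFn n (-a) = -ofFn n a := map_neg (ofFnHom A n) a

theorem ofFn_zero : ofFn n (0 : A) = 0 := map_zero (ofFnHom A n)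

theorem ofFn_one : ofFn n (1 : A) = 1 := map_one (ofFnHom A n)

theorem ofFn_sum {ι : Type*} (s : Finset ι) (f : ι → A) :
    ofFn n (∑ i ∈ s, f i) = ∑ i ∈ s, ofFn n (f i) := map_sum (ofFnHom A n) f s

/-! ### Powers of the formal parameter and the projection onto the Fock space -/

theorem nuPow_mul (N N' : ℤ) : nuPow A n N * nuPow A n N' = nuPow A n (N + N') := by
  simp [nuPow]

theorem nuPow_zero : nuPow A n 0 = 1 := rfl

theorem coeff_nuPow_mul (N m : ℤ) (f : Wick A n) :
    (nuPow A n N * f).coeff m = f.coeff (m - N) := by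
  rw [nuPow, HahnSeries.coeff_single_mul, one_mul]

theorem liftNu_nuPow_mul (φ : Fib A n →ₗ[ℂ] Fib A n) (N : ℤ) (f : Wick A n) :
    liftNu φ (nuPow A n N * f) = nuPow A n N * liftNu φ f := by
  ext1; funext m
  rw [liftNu_coeff, coeff_nuPow_mul, coeff_nuPow_mul, liftNu_coeff]

theorem fibDeriv_nuPow_mul (i : Idx n) (N : ℤ) (f : Wick A n) :
    fibDeriv A i (nuPow A n N * f) = nuPow A n N * fibDeriv A i f :=
  liftNu_nuPow_mul _ N f

theorem baseOp_nuPow_mul (φ : A →ₗ[ℂ] A) (N : ℤ) (f : Wick A n) :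
    baseOp n φ (nuPow A n N * f) = nuPow A n N * baseOp n φ f :=
  liftNu_nuPow_mul _ N f

theorem projV_nuPow_mul (N : ℤ) (f : Wick A n) :
    projV A n (nuPow A n N * f) = nuPow A n N * projV A n f :=
  liftNu_nuPow_mul _ N f

open Classical in
theorem coeff_projFib (f : Fib A n) (α : Idx n →₀ ℕ) :
    MvPowerSeries.coeff α (projFib A n f) =
      if ∀ l, α (Sum.inr l) = 0 then MvPowerSeries.coeff α f else 0 := by
  change (if _ then f α else 0) = _
  congr 1

theorem projFib_mul (f h : Fib A n) : projFib A n (f * h) = projFib A n f * projFib A n h := by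
  classical
  ext α
  rw [coeff_projFib, MvPowerSeries.coeff_mul, MvPowerSeries.coeff_mul]
  split_ifs with hα
  · refine Finset.sum_congr rfl fun p hp => ?_
    have hp' : p.1 + p.2 = α := Finset.HasAntidiagonal.mem_antidiagonal.1 hp
    -- A sum of two exponents is free of `ζ̄` exactly when both are; this is why setting `ζ̄ = 0` is
    -- multiplicative.
    have key : ∀ l, p.1 (Sum.inr l) = 0 ∧ p.2 (Sum.inr l) = 0 := fun l => by
      have := hα l
      rw [← hp', Finsupp.add_apply] at this
      omega
    rw [coeff_projFib, coeff_projFib, if_pos fun l => (key l).1, if_pos fun l => (key l).2]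
  · refine (Finset.sum_eq_zero fun p hp => ?_).symm
    have hp' : p.1 + p.2 = α := Finset.HasAntidiagonal.mem_antidiagonal.1 hp
    rw [coeff_projFib, coeff_projFib]
    split_ifs with h1 h2
    · exact absurd (fun l => by rw [← hp', Finsupp.add_apply, h1 l, h2 l]) hα
    all_goals simp

theorem projV_mul (f h : Wick A n) : projV A n (f * h) = projV A n f * projV A n h :=
  liftNu_mul projFib_mul f h

theorem projV_of_mem {f : Wick A n} (hf : f ∈ Fock A n) : projV A n f = f := by
  classical
  ext N α
  change MvPowerSeries.coeff α (projFib A n (f.coeff N)) = _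
  rw [coeff_projFib]
  split_ifs with h
  · rfl
  · push Not at h
    exact (hf N α h).symm

theorem projV_fibVar_inr (l : Fin n) : projV A n (fibVar A (Sum.inr l)) = 0 := by
  classical
  rw [projV, fibVar, liftNu_C]
  convert map_zero (HahnSeries.C (Γ := ℤ) (R := Fib A n))
  ext α
  rw [coeff_projFib, MvPowerSeries.coeff_X, map_zero]
  split_ifs with h1 h2
  · subst h2
    simpa using h1 l
  all_goals rfl

theorem projV_fibDeriv_inl (k : Fin n) (f : Wick A n) :
    projV A n (fibDeriv A (Sum.inl k) f) = fibDeriv A (Sum.inl k) (projV A n f) := by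
  classical
  ext N α
  change MvPowerSeries.coeff α (projFib A n (MvPowerSeries.pderiv A _ (f.coeff N))) =
    MvPowerSeries.coeff α (MvPowerSeries.pderiv A _ (projFib A n (f.coeff N)))
  rw [coeff_projFib, MvPowerSeries.coeff_pderiv, MvPowerSeries.coeff_pderiv, coeff_projFib]
  simp

theorem projV_baseOp (φ : A →ₗ[ℂ] A) (f : Wick A n) :
    projV A n (baseOp n φ f) = baseOp n φ (projV A n f) := by
  classical
  ext N α
  change MvPowerSeries.coeff α (projFib A n (coeffwise n φ (f.coeff N))) =
    φ (MvPowerSeries.coeff α (projFib A n (f.coeff N)))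
  rw [coeff_projFib, coeff_projFib, coeff_coeffwise]
  split_ifs <;> simp

theorem fibDeriv_inr_of_mem (l : Fin n) {f : Wick A n} (hf : f ∈ Fock A n) :
    fibDeriv A (Sum.inr l) f = 0 := by
  ext N α
  change MvPowerSeries.coeff α (MvPowerSeries.pderiv A _ (f.coeff N)) = 0
  rw [MvPowerSeries.coeff_pderiv, hf N _ ⟨l, by simp⟩, zero_mul]

end Operators

/-! ## The Wick product: filtration, Leibniz rules, associativity -/

section WickProduct

variable {A : Type} [CommRing A] [Algebra ℂ A] {n : ℕ}

/-- The elements of the Wick algebra that are divisible by `ν ^ M`. -/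
def nuFiltration (A : Type) [CommRing A] [Algebra ℂ A] (n : ℕ) (M : ℤ) :
    Submodule ℂ (Wick A n) where
  carrier := {w | ∀ m < M, w.coeff m = 0}
  zero_mem' := fun N _ => rfl
  add_mem' := fun {x y} hx hy N h => by
    rw [HahnSeries.coeff_add, hx N h, hy N h, add_zero]
  smul_mem' := fun c x hx N h => by rw [HahnSeries.coeff_smul, hx N h, smul_zero]

theorem exists_mem_nuFiltration (f : Wick A n) : ∃ a, f ∈ nuFiltration A n a := exists_bound f

theorem nuFiltration_mono {M M' : ℤ} (h : M ≤ M') : nuFiltration A n M' ≤ nuFiltration A n M :=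
  fun _ hw m hm => hw m (lt_of_lt_of_le hm h)

/-- The `ν`-adic filtration is separated. Every identity between infinite Wick products below is
proved by this criterion. -/
theorem eq_of_sub_mem_nuFiltration {x y : Wick A n} (a : ℤ)
    (h : ∀ K : ℕ, x - y ∈ nuFiltration A n (a + K)) : x = y := by
  rw [← sub_eq_zero]
  ext1; funext m
  exact h (m - a + 1).toNat m (by omega)

theorem nuPow_mul_mem {M : ℤ} (N : ℤ) {w : Wick A n} (hw : w ∈ nuFiltration A n M) :
    nuPow A n N * w ∈ nuFiltration A n (M + N) := fun m hm => by
  rw [coeff_nuPow_mul]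
  exact hw _ (by omega)

theorem liftNu_mem_nuFiltration (φ : Fib A n →ₗ[ℂ] Fib A n) {M : ℤ} {w : Wick A n}
    (hw : w ∈ nuFiltration A n M) : liftNu φ w ∈ nuFiltration A n M :=
  liftNu_bound φ hw

theorem mul_mem_nuFiltration {a b : ℤ} {f h : Wick A n} (hf : f ∈ nuFiltration A n a)
    (hh : h ∈ nuFiltration A n b) : f * h ∈ nuFiltration A n (a + b) :=
  mul_bound hf hh

theorem ofFn_mem_nuFiltration (a : A) : ofFn n a ∈ nuFiltration A n 0 := fun _ hm =>
  HahnSeries.coeff_single_of_ne (ne_of_lt hm)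

theorem fibVar_mem_nuFiltration (i : Idx n) : fibVar A i ∈ nuFiltration A n 0 := fun _ hm =>
  HahnSeries.coeff_single_of_ne (ne_of_lt hm)

variable (g : Matrix (Fin n) (Fin n) A)

theorem wickTerm_zero (f h : Wick A n) : wickTerm g 0 f h = f * h := rfl

theorem wickTerm_succ (r : ℕ) (f h : Wick A n) :
    wickTerm g (r + 1) f h = ∑ l, ∑ k, ofFn n (g⁻¹ l k) *
      wickTerm g r (fibDeriv A (Sum.inr l) f) (fibDeriv A (Sum.inl k) h) := by
  simp only [wickTerm, LinearMap.sum_apply]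
  rfl

theorem wickTerm_mem_nuFiltration (r : ℕ) {a b : ℤ} {f h : Wick A n}
    (hf : f ∈ nuFiltration A n a) (hh : h ∈ nuFiltration A n b) :
    wickTerm g r f h ∈ nuFiltration A n (a + b) :=
  wickTerm_bound g r hf hh

/-- Factors constant along the fibres are never differentiated. This covers both functions of the
base point and powers of `ν`. -/
theorem wickTerm_const_mul_left (r : ℕ) {c : Wick A n}
    (hc : ∀ i, fibDeriv A i c = 0) (f h : Wick A n) :
    wickTerm g r (c * f) h = c * wickTerm g r f h := by
  induction r generalizing f h with
  | zero => exact mul_assoc _ _ _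
  | succ r ih =>
    simp only [wickTerm_succ, fibDeriv_leibniz, hc, zero_mul, zero_add, ih, Finset.mul_sum,
      mul_left_comm c]

theorem wickTerm_const_mul_right (r : ℕ) {c : Wick A n}
    (hc : ∀ i, fibDeriv A i c = 0) (f h : Wick A n) :
    wickTerm g r f (c * h) = c * wickTerm g r f h := by
  induction r generalizing f h with
  | zero => exact mul_left_comm _ _ _
  | succ r ih =>
    simp only [wickTerm_succ, fibDeriv_leibniz, hc, zero_mul, zero_add, ih, Finset.mul_sum,
      mul_left_comm c]

theorem fibDeriv_nuPow (i : Idx n) (N : ℤ) : fibDeriv A i (nuPow A n N) = 0 := by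
  have h := fibDeriv_nuPow_mul (A := A) i N 1
  rw [mul_one] at h
  rw [h, ← ofFn_one, fibDeriv_ofFn, mul_zero]

theorem fibDeriv_wickTerm (i : Idx n) (r : ℕ) (f h : Wick A n) :
    fibDeriv A i (wickTerm g r f h) =
      wickTerm g r (fibDeriv A i f) h + wickTerm g r f (fibDeriv A i h) := by
  induction r generalizing f h with
  | zero => exact fibDeriv_leibniz i f h
  | succ r ih =>
    simp only [wickTerm_succ, map_sum, fibDeriv_ofFn_mul, ih, mul_add, Finset.sum_add_distrib,
      fibDeriv_comm i]

/-- The partial sums of the Wick product. -/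
def wickPartial (K : ℕ) (f h : Wick A n) : Wick A n :=
  ∑ r ∈ Finset.range K, ((r.factorial : ℂ)⁻¹) • (nuPow A n r * wickTerm g r f h)

theorem wick_coeff (f h : Wick A n) (N : ℤ) : (wick g f h).coeff N = wickCoeff g f h N := rfl

/-- The term of order `r` carries `ν^r` on top of the orders `a` and `b` of the factors, so the
omitted terms start at `a + b + K`. -/
theorem wick_sub_wickPartial_mem (K : ℕ) {a b : ℤ} {f h : Wick A n}
    (hf : f ∈ nuFiltration A n a) (hh : h ∈ nuFiltration A n b) :
    wick g f h - wickPartial g K f h ∈ nuFiltration A n (a + b + K) := by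
  intro m hm
  rw [HahnSeries.coeff_sub, wick_coeff, wickCoeff, sub_eq_zero,
    finsum_eq_sum_of_support_subset (s := Finset.range K)]
  · simp only [wickPartial, HahnSeries.coeff_sum, HahnSeries.coeff_smul, coeff_nuPow_mul]
  · intro r hr
    rw [Finset.coe_range, Set.mem_Iio]
    by_contra hlt
    exact hr (by
      simp only
      rw [wickTerm_bound g r hf hh (m - r) (by omega), smul_zero])

theorem wick_mem_nuFiltration {a b : ℤ} {f h : Wick A n}
    (hf : f ∈ nuFiltration A n a) (hh : h ∈ nuFiltration A n b) :
    wick g f h ∈ nuFiltration A n (a + b) := by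
  have := wick_sub_wickPartial_mem g 0 hf hh
  simpa [wickPartial] using this

theorem wick_eq_wickPartial (K : ℕ) {f h : Wick A n}
    (hz : ∀ r, wickTerm g (K + r) f h = 0) : wick g f h = wickPartial g K f h := by
  obtain ⟨a, ha⟩ := exists_mem_nuFiltration f
  obtain ⟨b, hb⟩ := exists_mem_nuFiltration h
  refine eq_of_sub_mem_nuFiltration (a + b) fun L => ?_
  have h1 := wick_sub_wickPartial_mem g (K + L) ha hb
  have h2 : wickPartial g (K + L) f h = wickPartial g K f h := by
    rw [wickPartial, Finset.sum_range_add, ← wickPartial, add_eq_left]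
    exact Finset.sum_eq_zero fun r _ => by rw [hz, mul_zero, smul_zero]
  rw [h2] at h1
  exact nuFiltration_mono (by push_cast; omega) h1

theorem wickPartial_two (f h : Wick A n) :
    wickPartial g 2 f h = f * h + nuPow A n 1 * ∑ l, ∑ k, ofFn n (g⁻¹ l k) *
      (fibDeriv A (Sum.inr l) f * fibDeriv A (Sum.inl k) h) := by
  simp [wickPartial, Finset.sum_range_succ, wickTerm_succ, wickTerm_zero, nuPow_zero]

/-- A left factor of degree at most one in `ζ̄` admits at most one contraction. This makes the
products with `ϑ`, with `R` and with functions explicit. -/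
theorem wick_of_fibDeriv_inr_inr_eq_zero {f : Wick A n}
    (hf : ∀ l l', fibDeriv A (Sum.inr l) (fibDeriv A (Sum.inr l') f) = 0) (h : Wick A n) :
    wick g f h = f * h + nuPow A n 1 * ∑ l, ∑ k, ofFn n (g⁻¹ l k) *
      (fibDeriv A (Sum.inr l) f * fibDeriv A (Sum.inl k) h) := by
  rw [wick_eq_wickPartial g 2, wickPartial_two]
  intro r
  rw [show 2 + r = r + 1 + 1 by ring]
  simp only [wickTerm_succ, hf, map_zero, LinearMap.zero_apply, mul_zero, Finset.sum_const_zero]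

theorem wick_of_fibDeriv_inl_inl_eq_zero (f : Wick A n) {h : Wick A n}
    (hh : ∀ k k', fibDeriv A (Sum.inl k) (fibDeriv A (Sum.inl k') h) = 0) :
    wick g f h = f * h + nuPow A n 1 * ∑ l, ∑ k, ofFn n (g⁻¹ l k) *
      (fibDeriv A (Sum.inr l) f * fibDeriv A (Sum.inl k) h) := by
  rw [wick_eq_wickPartial g 2, wickPartial_two]
  intro r
  rw [show 2 + r = r + 1 + 1 by ring]
  simp only [wickTerm_succ, hh, map_zero, mul_zero, Finset.sum_const_zero]

/-- An operator which is continuous and linear in `ν` and a derivation of all terms of the Wick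
product is a derivation of the Wick product. -/
theorem wick_leibniz {X : Wick A n →ₗ[ℂ] Wick A n}
    (hfil : ∀ M, ∀ w ∈ nuFiltration A n M, X w ∈ nuFiltration A n M)
    (hnu : ∀ N w, X (nuPow A n N * w) = nuPow A n N * X w)
    (hX : ∀ r f h, X (wickTerm g r f h) = wickTerm g r (X f) h + wickTerm g r f (X h))
    (f h : Wick A n) : X (wick g f h) = wick g (X f) h + wick g f (X h) := by
  obtain ⟨a, ha⟩ := exists_mem_nuFiltration f
  obtain ⟨b, hb⟩ := exists_mem_nuFiltration h
  refine eq_of_sub_mem_nuFiltration (a + b) fun K => ?_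
  have h1 := hfil _ _ (wick_sub_wickPartial_mem g K ha hb)
  have h2 := wick_sub_wickPartial_mem g K (hfil _ _ ha) hb
  have h3 := wick_sub_wickPartial_mem g K ha (hfil _ _ hb)
  have h4 : X (wickPartial g K f h) = wickPartial g K (X f) h + wickPartial g K f (X h) := by
    simp only [wickPartial, map_sum, map_smul, hnu, hX, mul_add, smul_add, Finset.sum_add_distrib]
  rw [map_sub, h4] at h1
  have := sub_mem (sub_mem h1 h2) h3
  convert this using 1
  abel

/-! ### Associativity of the Wick product -/

/-- A bidifferential contraction acting on functions of tuples of elements of the Wick algebra;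
`p` and `q` differentiate the two entries that are contracted. -/
def contraction {V : Type} (p q : Idx n → V → V) : Module.End ℂ (V → Wick A n) where
  toFun τ v := ∑ l, ∑ k, ofFn n (g⁻¹ l k) * τ (p (Sum.inr l) (q (Sum.inl k) v))
  map_add' τ τ' := by
    funext v
    simp [mul_add, Finset.sum_add_distrib]
  map_smul' c τ := by
    funext v
    simp [Finset.smul_sum]

theorem contraction_apply {V : Type} (p q : Idx n → V → V) (τ : V → Wick A n) (v : V) :
    contraction g p q τ v =
      ∑ l, ∑ k, ofFn n (g⁻¹ l k) * τ (p (Sum.inr l) (q (Sum.inl k) v)) := rfl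

theorem contraction_commute {V : Type} {p q p' q' : Idx n → V → V}
    (h1 : ∀ i j v, p i (p' j v) = p' j (p i v)) (h2 : ∀ i j v, p i (q' j v) = q' j (p i v))
    (h3 : ∀ i j v, q i (p' j v) = p' j (q i v)) (h4 : ∀ i j v, q i (q' j v) = q' j (q i v)) :
    Commute (contraction g p q) (contraction g p' q') := by
  refine LinearMap.ext fun τ => funext fun v => ?_
  rw [Module.End.mul_apply, Module.End.mul_apply]
  simp only [contraction_apply, Finset.mul_sum]
  rw [Finset.sum_congr rfl fun _ _ => Finset.sum_comm, Finset.sum_comm]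
  refine Finset.sum_congr rfl fun l _ => ?_
  rw [Finset.sum_congr rfl fun _ _ => Finset.sum_comm, Finset.sum_comm]
  refine Finset.sum_congr rfl fun k _ => Finset.sum_congr rfl fun l' _ =>
    Finset.sum_congr rfl fun k' _ => ?_
  rw [mul_left_comm]
  simp only [h1, h2, h3, h4]

/-- Differentiation of the first entry of a triple. -/
def derivFst (i : Idx n) (v : Wick A n × Wick A n × Wick A n) : Wick A n × Wick A n × Wick A n :=
  (fibDeriv A i v.1, v.2.1, v.2.2)

/-- Differentiation of the second entry of a triple. -/
def derivSnd (i : Idx n) (v : Wick A n × Wick A n × Wick A n) : Wick A n × Wick A n × Wick A n :=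
  (v.1, fibDeriv A i v.2.1, v.2.2)

/-- Differentiation of the third entry of a triple. -/
def derivThd (i : Idx n) (v : Wick A n × Wick A n × Wick A n) : Wick A n × Wick A n × Wick A n :=
  (v.1, v.2.1, fibDeriv A i v.2.2)

/-- The contraction of the first with the second entry of a triple. -/
def contrFstSnd : Module.End ℂ (Wick A n × Wick A n × Wick A n → Wick A n) :=
  contraction g derivFst derivSnd

theorem contrFstSnd_apply (τ : Wick A n × Wick A n × Wick A n → Wick A n)
    (v : Wick A n × Wick A n × Wick A n) : contrFstSnd g τ v = ∑ l, ∑ k, ofFn n (g⁻¹ l k) *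
      τ (fibDeriv A (Sum.inr l) v.1, fibDeriv A (Sum.inl k) v.2.1, v.2.2) := rfl

/-- The contraction of the first with the third entry of a triple. -/
def contrFstThd : Module.End ℂ (Wick A n × Wick A n × Wick A n → Wick A n) :=
  contraction g derivFst derivThd

theorem contrFstThd_apply (τ : Wick A n × Wick A n × Wick A n → Wick A n)
    (v : Wick A n × Wick A n × Wick A n) : contrFstThd g τ v = ∑ l, ∑ k, ofFn n (g⁻¹ l k) *
      τ (fibDeriv A (Sum.inr l) v.1, v.2.1, fibDeriv A (Sum.inl k) v.2.2) := rfl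

/-- The contraction of the second with the third entry of a triple. -/
def contrSndThd : Module.End ℂ (Wick A n × Wick A n × Wick A n → Wick A n) :=
  contraction g derivSnd derivThd

theorem contrSndThd_apply (τ : Wick A n × Wick A n × Wick A n → Wick A n)
    (v : Wick A n × Wick A n × Wick A n) : contrSndThd g τ v = ∑ l, ∑ k, ofFn n (g⁻¹ l k) *
      τ (v.1, fibDeriv A (Sum.inr l) v.2.1, fibDeriv A (Sum.inl k) v.2.2) := rfl

/-- The product of the entries of a triple. -/
def tripleMul (v : Wick A n × Wick A n × Wick A n) : Wick A n := v.1 * v.2.1 * v.2.2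

theorem contrFstSnd_commute_contrFstThd : Commute (contrFstSnd g) (contrFstThd g) :=
  contraction_commute g (fun i j v => by simp only [derivFst, fibDeriv_comm i j])
    (fun _ _ _ => rfl) (fun _ _ _ => rfl) (fun _ _ _ => rfl)

theorem contrFstSnd_commute_contrSndThd : Commute (contrFstSnd g) (contrSndThd g) :=
  contraction_commute g (fun _ _ _ => rfl) (fun _ _ _ => rfl)
    (fun i j v => by simp only [derivSnd, fibDeriv_comm i j]) (fun _ _ _ => rfl)

theorem contrFstThd_commute_contrSndThd : Commute (contrFstThd g) (contrSndThd g) :=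
  contraction_commute g (fun _ _ _ => rfl) (fun _ _ _ => rfl) (fun _ _ _ => rfl)
    (fun i j v => by simp only [derivThd, fibDeriv_comm i j])

/-- The degree `N` part of `exp X exp Z = exp (X + Z)` for commuting operators: the binomial theorem
divided by `N!`. -/
theorem exp_add_antidiagonal {V : Type} {X Z : Module.End ℂ (V → Wick A n)} (hXZ : Commute X Z)
    (N : ℕ) (τ : V → Wick A n) (v : V) :
    ∑ s ∈ Finset.range (N + 1), ((s.factorial : ℂ)⁻¹ * (((N - s).factorial : ℂ)⁻¹)) •
      ((X ^ s) ((Z ^ (N - s)) τ)) v = ((N.factorial : ℂ)⁻¹) • ((X + Z) ^ N) τ v := by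
  rw [hXZ.add_pow, LinearMap.sum_apply, Finset.sum_apply, Finset.smul_sum]
  refine Finset.sum_congr rfl fun s hs => ?_
  have hs' : s ≤ N := Nat.lt_succ_iff.1 (Finset.mem_range.1 hs)
  rw [← nsmul_eq_mul', LinearMap.smul_apply, Pi.smul_apply, Module.End.mul_apply,
    ← Nat.cast_smul_eq_nsmul ℂ, smul_smul]
  congr 1
  rw [Nat.cast_choose ℂ hs']
  have := Nat.cast_ne_zero (R := ℂ).2 N.factorial_ne_zero
  field_simp

/-- This is `exp (νX) exp (νZ) = exp (ν(X + Z))` modulo `ν^K`; the index set is the triangle `s + r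
< K`, regrouped by `N = s + r`. -/
theorem sum_triangle_eq {V : Type} {X Z : Module.End ℂ (V → Wick A n)} (hXZ : Commute X Z)
    (K : ℕ) (τ : V → Wick A n) (v : V) :
    ∑ s ∈ Finset.range K, ((s.factorial : ℂ)⁻¹) • (nuPow A n s *
      ∑ r ∈ Finset.range (K - s), ((r.factorial : ℂ)⁻¹) •
        (nuPow A n r * ((X ^ s) ((Z ^ r) τ)) v)) =
    ∑ N ∈ Finset.range K, nuPow A n N * ((N.factorial : ℂ)⁻¹) • ((X + Z) ^ N) τ v := by
  simp only [← exp_add_antidiagonal hXZ, Finset.mul_sum, Finset.smul_sum]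
  rw [← Finset.sum_range_diag_flip K (fun s r => ((s.factorial : ℂ)⁻¹) • (nuPow A n s *
      ((r.factorial : ℂ)⁻¹) • (nuPow A n r * ((X ^ s) ((Z ^ r) τ)) v)))]
  refine Finset.sum_congr rfl fun N _ => Finset.sum_congr rfl fun s hs => ?_
  have hs' : s ≤ N := Nat.lt_succ_iff.1 (Finset.mem_range.1 hs)
  rw [mul_smul_comm, smul_smul, mul_smul_comm, ← mul_assoc, nuPow_mul]
  congr 3
  rw [Nat.cast_sub hs']
  ring_nf

/-- A derivative of the inner product falls on its first or on its second factor, so the outer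
contraction is the sum of the contractions of the third entry with these two. -/
theorem wickTerm_wickTerm_left (s r : ℕ) (v : Wick A n × Wick A n × Wick A n) :
    wickTerm g s (wickTerm g r v.1 v.2.1) v.2.2 =
      ((contrFstThd g + contrSndThd g) ^ s)
        ((contrFstSnd g ^ r) tripleMul) v := by
  induction s generalizing v with
  | zero =>
    rw [pow_zero, Module.End.one_apply, wickTerm_zero]
    induction r generalizing v with
    | zero => rfl
    | succ r ih =>
      rw [pow_succ', Module.End.mul_apply, contrFstSnd_apply, wickTerm_succ]
      simp only [← ih, Finset.sum_mul, mul_assoc]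
  | succ s ih =>
    rw [pow_succ', Module.End.mul_apply, LinearMap.add_apply, Pi.add_apply, contrFstThd_apply,
      contrSndThd_apply, wickTerm_succ]
    simp only [← ih, fibDeriv_wickTerm, map_add,
      LinearMap.add_apply, mul_add, Finset.sum_add_distrib]

theorem wickTerm_wickTerm_right (s r : ℕ) (v : Wick A n × Wick A n × Wick A n) :
    wickTerm g s v.1 (wickTerm g r v.2.1 v.2.2) =
      ((contrFstSnd g + contrFstThd g) ^ s)
        ((contrSndThd g ^ r) tripleMul) v := by
  induction s generalizing v with
  | zero =>
    rw [pow_zero, Module.End.one_apply, wickTerm_zero]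
    induction r generalizing v with
    | zero => exact (mul_assoc _ _ _).symm
    | succ r ih =>
      rw [pow_succ', Module.End.mul_apply, contrSndThd_apply, wickTerm_succ]
      simp only [← ih, Finset.mul_sum, mul_left_comm]
  | succ s ih =>
    rw [pow_succ', Module.End.mul_apply, LinearMap.add_apply, Pi.add_apply, contrFstSnd_apply,
      contrFstThd_apply, wickTerm_succ]
    simp only [← ih, fibDeriv_wickTerm, map_add,
      mul_add, Finset.sum_add_distrib]

/-- The outer term of order `s` already supplies `ν^s`, so the inner product is needed only up to `K
- s` terms. This gives the triangular truncation that `sum_triangle_eq` regroups. -/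
theorem wick_wick_left_mem (K : ℕ) {a b c : ℤ} {f h k : Wick A n} (hf : f ∈ nuFiltration A n a)
    (hh : h ∈ nuFiltration A n b) (hk : k ∈ nuFiltration A n c) :
    wick g (wick g f h) k - ∑ s ∈ Finset.range K, ((s.factorial : ℂ)⁻¹) • (nuPow A n s *
      ∑ r ∈ Finset.range (K - s), ((r.factorial : ℂ)⁻¹) •
        (nuPow A n r * wickTerm g s (wickTerm g r f h) k)) ∈ nuFiltration A n (a + b + c + K) := by
  have h1 := wick_sub_wickPartial_mem g K (wick_mem_nuFiltration g hf hh) hk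
  rw [← sub_add_sub_cancel]
  refine add_mem (nuFiltration_mono (by omega) h1) ?_
  rw [wickPartial, ← Finset.sum_sub_distrib]
  refine Submodule.sum_mem _ fun s hs => ?_
  rw [← smul_sub, ← mul_sub]
  refine Submodule.smul_mem _ _ ?_
  have h2 := wickTerm_mem_nuFiltration g s (wick_sub_wickPartial_mem g (K - s) hf hh) hk
  have h3 := nuFiltration_mono (M := a + b + c + K)
    (by have := (Finset.mem_range.1 hs).le; push_cast [this]; omega) (nuPow_mul_mem s h2)
  simpa only [wickPartial, map_sub, map_sum, map_smul, LinearMap.sub_apply, LinearMap.sum_apply,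
    LinearMap.smul_apply, wickTerm_const_mul_left g _ (fibDeriv_nuPow · _)] using h3

theorem wick_wick_right_mem (K : ℕ) {a b c : ℤ} {f h k : Wick A n} (hf : f ∈ nuFiltration A n a)
    (hh : h ∈ nuFiltration A n b) (hk : k ∈ nuFiltration A n c) :
    wick g f (wick g h k) - ∑ s ∈ Finset.range K, ((s.factorial : ℂ)⁻¹) • (nuPow A n s *
      ∑ r ∈ Finset.range (K - s), ((r.factorial : ℂ)⁻¹) •
        (nuPow A n r * wickTerm g s f (wickTerm g r h k))) ∈ nuFiltration A n (a + b + c + K) := by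
  have h1 := wick_sub_wickPartial_mem g K hf (wick_mem_nuFiltration g hh hk)
  rw [← sub_add_sub_cancel]
  refine add_mem (nuFiltration_mono (by omega) h1) ?_
  rw [wickPartial, ← Finset.sum_sub_distrib]
  refine Submodule.sum_mem _ fun s hs => ?_
  rw [← smul_sub, ← mul_sub]
  refine Submodule.smul_mem _ _ ?_
  have h2 := wickTerm_mem_nuFiltration g s hf (wick_sub_wickPartial_mem g (K - s) hh hk)
  have h3 := nuFiltration_mono (M := a + b + c + K)
    (by have := (Finset.mem_range.1 hs).le; push_cast [this]; omega) (nuPow_mul_mem s h2)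
  simpa only [wickPartial, map_sub, map_sum, map_smul, LinearMap.sub_apply, LinearMap.sum_apply,
    LinearMap.smul_apply, wickTerm_const_mul_right g _ (fibDeriv_nuPow · _)] using h3

theorem wick_assoc (f h k : Wick A n) : wick g (wick g f h) k = wick g f (wick g h k) := by
  obtain ⟨a, ha⟩ := exists_mem_nuFiltration f
  obtain ⟨b, hb⟩ := exists_mem_nuFiltration h
  obtain ⟨c, hc⟩ := exists_mem_nuFiltration k
  refine eq_of_sub_mem_nuFiltration (a + b + c) fun K => ?_
  have h1 := wick_wick_left_mem g K ha hb hc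
  have h2 := wick_wick_right_mem g K ha hb hc
  have hL := fun s r => wickTerm_wickTerm_left g s r (f, h, k)
  have hR := fun s r => wickTerm_wickTerm_right g s r (f, h, k)
  simp only at hL hR
  simp only [hL] at h1
  simp only [hR] at h2
  -- With `C12`, `C13`, `C23` the three pairwise contractions, one bracketing is `exp ν(C13 + C23)
  -- exp νC12`, the other `exp ν(C12 + C13) exp νC23`. All three commute, so both equal `exp ν(C12 +
  -- C13 + C23)`.
  rw [sum_triangle_eq ((contrFstSnd_commute_contrFstThd g).symm.add_left
    (contrFstSnd_commute_contrSndThd g).symm),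
    ← add_rotate (contrFstSnd g)] at h1
  rw [sum_triangle_eq ((contrFstSnd_commute_contrSndThd g).add_left
    (contrFstThd_commute_contrSndThd g))] at h2
  simpa using sub_mem h1 h2

end WickProduct

/-! ## The Kähler connection and the Wick product -/

section Connection

variable {A : Type} [CommRing A] [Algebra ℂ A] {n : ℕ}

/-- Commuting derivations `d` and a nondegenerate metric `g` which satisfies the Kähler
condition. -/
structure IsKahlerData (d : Idx n → A →ₗ[ℂ] A) (g : Matrix (Fin n) (Fin n) A) : Prop where
  leibniz : ∀ i a b, d i (a * b) = d i a * b + a * d i b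
  comm : ∀ i j a, d i (d j a) = d j (d i a)
  isUnit_det : IsUnit g.det
  hol : ∀ i k l, d (Sum.inl i) (g k l) = d (Sum.inl k) (g i l)
  bar : ∀ j k l, d (Sum.inr j) (g k l) = d (Sum.inr l) (g k j)

variable {d : Idx n → A →ₗ[ℂ] A} {g : Matrix (Fin n) (Fin n) A}

theorem map_matrix_mul {φ : A →ₗ[ℂ] A} (hφ : ∀ x y, φ (x * y) = φ x * y + x * φ y)
    (M N : Matrix (Fin n) (Fin n) A) : (M * N).map φ = M.map φ * N + M * N.map φ := by
  ext i j
  simp [Matrix.mul_apply, hφ, Finset.sum_add_distrib]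

theorem map_matrix_inv {φ : A →ₗ[ℂ] A} (hφ : ∀ x y, φ (x * y) = φ x * y + x * φ y)
    (hg : IsUnit g.det) : (g⁻¹).map φ = -(g⁻¹ * g.map φ * g⁻¹) := by
  have h := map_matrix_mul hφ g⁻¹ g
  rw [Matrix.nonsing_inv_mul g hg] at h
  have h0 : (1 : Matrix (Fin n) (Fin n) A).map φ = 0 := by
    ext i j
    rw [Matrix.map_apply, Matrix.one_apply]
    split_ifs <;> simp [map_one_of_leibniz hφ]
  rw [h0] at h
  have h2 : (g⁻¹).map φ * g = -(g⁻¹ * g.map φ) := eq_neg_of_add_eq_zero_left h.symm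
  rw [← neg_mul, ← h2, Matrix.mul_assoc, Matrix.mul_nonsing_inv g hg, Matrix.mul_one]

namespace IsKahlerData

variable (H : IsKahlerData d g)
include H

theorem map_inv (i : Idx n) (l s : Fin n) :
    d i (g⁻¹ l s) = -∑ b, ∑ a, g⁻¹ l a * d i (g a b) * g⁻¹ b s := by
  have h := congrFun (congrFun (map_matrix_inv (H.leibniz i) H.isUnit_det) l) s
  simpa [Matrix.mul_apply, Finset.sum_mul] using h

/-- The Kähler condition in the form of vanishing torsion: the Christoffel symbols are symmetric in
their lower indices. -/
theorem christoffel_eq (s k i : Fin n) :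
    christoffel d g s k i = ∑ l, g⁻¹ l s * d (Sum.inl k) (g i l) := by
  simp only [christoffel, H.hol i k]

theorem christoffelBar_eq (t l j : Fin n) :
    christoffelBar d g t l j = ∑ k, g⁻¹ t k * d (Sum.inr l) (g k j) := by
  simp only [christoffelBar, H.bar j _ l]

/-- The inverse metric is parallel: the derivative of an inverse matrix is `-g⁻¹ (∂g) g⁻¹`, and one
factor `g⁻¹` combines with `∂g` into a Christoffel symbol. -/
theorem map_inv_inl (k l s : Fin n) :
    d (Sum.inl k) (g⁻¹ l s) = -∑ m, g⁻¹ l m * christoffel d g s k m := by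
  rw [H.map_inv, Finset.sum_comm]
  simp only [H.christoffel_eq, Finset.mul_sum]
  congr 1
  exact Finset.sum_congr rfl fun _ _ => Finset.sum_congr rfl fun _ _ => by ring

theorem map_inv_inr (k t s : Fin n) :
    d (Sum.inr k) (g⁻¹ t s) = -∑ m, g⁻¹ m s * christoffelBar d g t k m := by
  rw [H.map_inv]
  simp only [H.christoffelBar_eq, Finset.mul_sum]
  congr 1
  exact Finset.sum_congr rfl fun _ _ => Finset.sum_congr rfl fun _ _ => by ring

theorem inv_mul_apply (a b : Fin n) : ∑ k, g⁻¹ a k * g k b = if a = b then 1 else 0 := by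
  rw [← Matrix.mul_apply, Matrix.nonsing_inv_mul g H.isUnit_det, Matrix.one_apply]

theorem mul_inv_apply (a b : Fin n) : ∑ l, g a l * g⁻¹ l b = if a = b then 1 else 0 := by
  rw [← Matrix.mul_apply, Matrix.mul_nonsing_inv g H.isUnit_det, Matrix.one_apply]

end IsKahlerData

/-! ### Covariant derivatives and their commutation with fibre derivatives -/

variable (d g)

/-- The components of the Kähler connection. -/
def nablaIdx : Idx n → Wick A n →ₗ[ℂ] Wick A n := Sum.elim (nablaHol d g) (nablaBar d g)

/-- The components of the Kähler connection on the Fock space. -/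
def nablaHatIdx : Idx n → Module.End ℂ (Fock A n) :=
  Sum.elim (fun k => (nablaHol d g k).restrict (fock_nablaHol d g k))
    (fun l => (baseOp n (d (Sum.inr l))).restrict fun _ hv => fock_baseOp (d (Sum.inr l)) hv)

theorem nablaHol_apply (k : Fin n) (w : Wick A n) :
    nablaHol d g k w = baseOp n (d (Sum.inl k)) w - ∑ s, ∑ i,
      ofFn n (christoffel d g s k i) * fibVar A (Sum.inl i) * fibDeriv A (Sum.inl s) w := by
  simp [nablaHol, mulBy, mul_assoc]

theorem nablaBar_apply (l : Fin n) (w : Wick A n) :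
    nablaBar d g l w = baseOp n (d (Sum.inr l)) w - ∑ t, ∑ j,
      ofFn n (christoffelBar d g t l j) * fibVar A (Sum.inr j) * fibDeriv A (Sum.inr t) w := by
  simp [nablaBar, mulBy, mul_assoc]

/-- The correction arises when `∂/∂ζ^m` hits the coefficient `ζ^i` of the connection term. -/
theorem fibDeriv_inl_nablaHol (k m : Fin n) (w : Wick A n) :
    fibDeriv A (Sum.inl m) (nablaHol d g k w) = nablaHol d g k (fibDeriv A (Sum.inl m) w) -
      ∑ s, ofFn n (christoffel d g s k m) * fibDeriv A (Sum.inl s) w := by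
  simp only [nablaHol_apply, map_sub, map_sum, baseOp_fibDeriv, mul_assoc, fibDeriv_ofFn,
    fibDeriv_leibniz, fibDeriv_fibVar_inl_inl, mul_add, Finset.sum_add_distrib, ite_mul, one_mul,
    zero_mul, zero_add, mul_ite, mul_zero, Finset.sum_ite_eq, Finset.mem_univ, if_true,
    fibDeriv_comm (Sum.inl m)]
  abel

theorem fibDeriv_inr_nablaHol (k m : Fin n) (w : Wick A n) :
    fibDeriv A (Sum.inr m) (nablaHol d g k w) = nablaHol d g k (fibDeriv A (Sum.inr m) w) := by
  simp only [nablaHol_apply, map_sub, map_sum, baseOp_fibDeriv, mul_assoc, fibDeriv_ofFn,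
    fibDeriv_leibniz, fibDeriv_fibVar_inr_inl, zero_mul, zero_add, fibDeriv_comm (Sum.inr m)]

theorem fibDeriv_inr_nablaBar (k m : Fin n) (w : Wick A n) :
    fibDeriv A (Sum.inr m) (nablaBar d g k w) = nablaBar d g k (fibDeriv A (Sum.inr m) w) -
      ∑ s, ofFn n (christoffelBar d g s k m) * fibDeriv A (Sum.inr s) w := by
  simp only [nablaBar_apply, map_sub, map_sum, baseOp_fibDeriv, mul_assoc, fibDeriv_ofFn,
    fibDeriv_leibniz, fibDeriv_fibVar_inr_inr, mul_add, Finset.sum_add_distrib, ite_mul, one_mul,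
    zero_mul, zero_add, mul_ite, mul_zero, Finset.sum_ite_eq, Finset.mem_univ, if_true,
    fibDeriv_comm (Sum.inr m)]
  abel

theorem fibDeriv_inl_nablaBar (k m : Fin n) (w : Wick A n) :
    fibDeriv A (Sum.inl m) (nablaBar d g k w) = nablaBar d g k (fibDeriv A (Sum.inl m) w) := by
  simp only [nablaBar_apply, map_sub, map_sum, baseOp_fibDeriv, mul_assoc, fibDeriv_ofFn,
    fibDeriv_leibniz, fibDeriv_fibVar_inl_inr, zero_mul, zero_add, fibDeriv_comm (Sum.inl m)]

theorem nablaIdx_mem_nuFiltration (i : Idx n) (M : ℤ) (w : Wick A n)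
    (hw : w ∈ nuFiltration A n M) : nablaIdx d g i w ∈ nuFiltration A n M := by
  have key : ∀ (c : A) (j j' : Idx n),
      ofFn n c * fibVar A j * fibDeriv A j' w ∈ nuFiltration A n M := fun c j j' => by
    have := mul_mem_nuFiltration (mul_mem_nuFiltration (ofFn_mem_nuFiltration c)
      (fibVar_mem_nuFiltration j)) (liftNu_mem_nuFiltration
      ((MvPowerSeries.pderiv A j').toLinearMap.restrictScalars ℂ) hw)
    rwa [add_zero, zero_add] at this
  rcases i with k | l
  · rw [nablaIdx, Sum.elim_inl, nablaHol_apply]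
    exact sub_mem (liftNu_mem_nuFiltration _ hw)
      (sum_mem fun _ _ => sum_mem fun _ _ => key _ _ _)
  · rw [nablaIdx, Sum.elim_inr, nablaBar_apply]
    exact sub_mem (liftNu_mem_nuFiltration _ hw)
      (sum_mem fun _ _ => sum_mem fun _ _ => key _ _ _)

theorem nablaIdx_nuPow_mul (i : Idx n) (N : ℤ) (w : Wick A n) :
    nablaIdx d g i (nuPow A n N * w) = nuPow A n N * nablaIdx d g i w := by
  rcases i with k | l
  · simp only [nablaIdx, Sum.elim_inl, nablaHol_apply, baseOp_nuPow_mul, fibDeriv_nuPow_mul,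
      mul_sub, Finset.mul_sum, mul_left_comm]
  · simp only [nablaIdx, Sum.elim_inr, nablaBar_apply, baseOp_nuPow_mul, fibDeriv_nuPow_mul,
      mul_sub, Finset.mul_sum, mul_left_comm]

variable {d g}

namespace IsKahlerData

variable (H : IsKahlerData d g)
include H

theorem nablaIdx_leibniz (i : Idx n) (f h : Wick A n) :
    nablaIdx d g i (f * h) = nablaIdx d g i f * h + f * nablaIdx d g i h := by
  rcases i with k | l
  · simp only [nablaIdx, Sum.elim_inl, nablaHol_apply, baseOp_leibniz (H.leibniz _),
      fibDeriv_leibniz, mul_add, Finset.sum_add_distrib, sub_mul, mul_sub, Finset.sum_mul,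
      Finset.mul_sum, mul_assoc, mul_left_comm f]
    ring
  · simp only [nablaIdx, Sum.elim_inr, nablaBar_apply, baseOp_leibniz (H.leibniz _),
      fibDeriv_leibniz, mul_add, Finset.sum_add_distrib, sub_mul, mul_sub, Finset.sum_mul,
      Finset.mul_sum, mul_assoc, mul_left_comm f]
    ring

omit H in
theorem nablaIdx_ofFn (i : Idx n) (a : A) : nablaIdx d g i (ofFn n a) = ofFn n (d i a) := by
  rcases i with k | l
  · simp [nablaIdx, nablaHol_apply, baseOp_ofFn]
  · simp [nablaIdx, nablaBar_apply, baseOp_ofFn]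

/-- Commuting `∇_i` past the two contracted derivatives produces Christoffel terms. They cancel
against the derivative of `g⁻¹` because the inverse metric is parallel. -/
theorem nablaIdx_wickTerm (i : Idx n) (r : ℕ) (f h : Wick A n) :
    nablaIdx d g i (wickTerm g r f h) =
      wickTerm g r (nablaIdx d g i f) h + wickTerm g r f (nablaIdx d g i h) := by
  induction r generalizing f h with
  | zero => exact H.nablaIdx_leibniz i f h
  | succ r ih =>
    simp only [wickTerm_succ, map_sum, H.nablaIdx_leibniz, nablaIdx_ofFn, ih, mul_add,
      Finset.sum_add_distrib]
    rcases i with p | q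
    · simp only [nablaIdx, Sum.elim_inl, fibDeriv_inl_nablaHol, fibDeriv_inr_nablaHol, map_sub,
        map_sum, mul_sub, Finset.sum_sub_distrib,
        wickTerm_const_mul_right g _ (fibDeriv_ofFn · _), H.map_inv_inl, ofFn_neg, ofFn_sum,
        ofFn_mul, neg_mul, Finset.sum_neg_distrib, Finset.sum_mul, Finset.mul_sum]
      have : ∀ l, ∑ k, ∑ m, ofFn n (g⁻¹ l m) * ofFn n (christoffel d g k p m) *
          wickTerm g r (fibDeriv A (Sum.inr l) f) (fibDeriv A (Sum.inl k) h) =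
          ∑ m, ∑ k, ofFn n (g⁻¹ l m) * (ofFn n (christoffel d g k p m) *
          wickTerm g r (fibDeriv A (Sum.inr l) f) (fibDeriv A (Sum.inl k) h)) := fun l => by
        rw [Finset.sum_comm]
        simp only [mul_assoc]
      simp only [this]
      abel
    · simp only [nablaIdx, Sum.elim_inr, fibDeriv_inr_nablaBar, fibDeriv_inl_nablaBar, map_sub,
        map_sum, mul_sub, Finset.sum_sub_distrib, LinearMap.sub_apply, LinearMap.sum_apply,
        wickTerm_const_mul_left g _ (fibDeriv_ofFn · _), H.map_inv_inr, ofFn_neg, ofFn_sum,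
        ofFn_mul, neg_mul, Finset.sum_neg_distrib, Finset.sum_mul, Finset.mul_sum]
      have : ∑ l, ∑ k, ∑ m, ofFn n (g⁻¹ m k) * ofFn n (christoffelBar d g l q m) *
          wickTerm g r (fibDeriv A (Sum.inr l) f) (fibDeriv A (Sum.inl k) h) =
          ∑ m, ∑ k, ∑ l, ofFn n (g⁻¹ m k) * (ofFn n (christoffelBar d g l q m) *
          wickTerm g r (fibDeriv A (Sum.inr l) f) (fibDeriv A (Sum.inl k) h)) := by
        simp only [mul_assoc]
        rw [Finset.sum_congr rfl fun _ _ => Finset.sum_comm, Finset.sum_comm]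
        exact Finset.sum_congr rfl fun _ _ => Finset.sum_comm
      simp only [this]
      abel

/-- The Kähler connection is a derivation of the Wick product. -/
theorem nablaIdx_wick (i : Idx n) (f h : Wick A n) :
    nablaIdx d g i (wick g f h) = wick g (nablaIdx d g i f) h + wick g f (nablaIdx d g i h) :=
  wick_leibniz g (nablaIdx_mem_nuFiltration d g i) (nablaIdx_nuPow_mul d g i)
    (H.nablaIdx_wickTerm i) f h

end IsKahlerData

/-- Used with `c = ν⁻¹`: it lets `ν⁻¹` pass through the action on the Fock space. -/
theorem wick_const_mul_left {c : Wick A n} (hc : ∀ i, fibDeriv A i c = 0) (f h : Wick A n) :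
    wick g (c * f) h = c * wick g f h := by
  obtain ⟨e, he⟩ := exists_mem_nuFiltration c
  obtain ⟨a, ha⟩ := exists_mem_nuFiltration f
  obtain ⟨b, hb⟩ := exists_mem_nuFiltration h
  refine eq_of_sub_mem_nuFiltration (e + a + b) fun K => ?_
  have h1 := wick_sub_wickPartial_mem g K (mul_mem_nuFiltration he ha) hb
  have h2 := mul_mem_nuFiltration he (wick_sub_wickPartial_mem g K ha hb)
  have h3 : wickPartial g K (c * f) h = c * wickPartial g K f h := by
    simp only [wickPartial, wickTerm_const_mul_left g _ hc, Finset.mul_sum, mul_smul_comm,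
      mul_left_comm]
  rw [h3] at h1
  rw [← add_assoc, ← add_assoc, mul_sub] at h2
  simpa using sub_mem h1 h2

theorem wick_const_mul_right {c : Wick A n} (hc : ∀ i, fibDeriv A i c = 0) (f h : Wick A n) :
    wick g f (c * h) = c * wick g f h := by
  obtain ⟨e, he⟩ := exists_mem_nuFiltration c
  obtain ⟨a, ha⟩ := exists_mem_nuFiltration f
  obtain ⟨b, hb⟩ := exists_mem_nuFiltration h
  refine eq_of_sub_mem_nuFiltration (e + a + b) fun K => ?_
  have h1 := wick_sub_wickPartial_mem g K ha (mul_mem_nuFiltration he hb)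
  have h2 := mul_mem_nuFiltration he (wick_sub_wickPartial_mem g K ha hb)
  have h3 : wickPartial g K f (c * h) = c * wickPartial g K f h := by
    simp only [wickPartial, wickTerm_const_mul_right g _ hc, Finset.mul_sum, mul_smul_comm,
      mul_left_comm]
  rw [h3] at h1
  rw [← add_assoc, ← add_assoc, mul_sub] at h2
  rw [← add_assoc, add_comm a e] at h1
  simpa using sub_mem h1 h2

/-! ### The action on the Fock space -/

theorem projV_ofFn (a : A) : projV A n (ofFn n a) = ofFn n a := projV_of_mem (fock_ofFn a)

theorem projV_projV (f : Wick A n) : projV A n (projV A n f) = projV A n f :=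
  projV_of_mem (projV_mem f)

theorem projV_wickTerm_projV (r : ℕ) (f h : Wick A n) :
    projV A n (wickTerm g r f (projV A n h)) = projV A n (wickTerm g r f h) := by
  induction r generalizing f h with
  | zero => rw [wickTerm_zero, wickTerm_zero, projV_mul, projV_projV, projV_mul]
  | succ r ih =>
    simp only [wickTerm_succ, map_sum, projV_mul, ← projV_fibDeriv_inl, ih]

/-- The kernel of `Π'` is a left ideal: the right factor is differentiated only in the `ζ^k`, and
these derivatives commute with setting `ζ̄ = 0`. -/
theorem projV_wick_projV (f h : Wick A n) :
    projV A n (wick g f (projV A n h)) = projV A n (wick g f h) := by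
  obtain ⟨a, ha⟩ := exists_mem_nuFiltration f
  obtain ⟨b, hb⟩ := exists_mem_nuFiltration h
  refine eq_of_sub_mem_nuFiltration (a + b) fun K => ?_
  have h1 := liftNu_mem_nuFiltration (projFib A n) (wick_sub_wickPartial_mem g K ha
    (liftNu_mem_nuFiltration (projFib A n) hb))
  have h2 := liftNu_mem_nuFiltration (projFib A n) (wick_sub_wickPartial_mem g K ha hb)
  rw [← projV, map_sub] at h1 h2
  have h3 : projV A n (wickPartial g K f (projV A n h)) = projV A n (wickPartial g K f h) := by
    simp only [wickPartial, map_sum, map_smul, projV_nuPow_mul, projV_wickTerm_projV]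
  rw [h3] at h1
  simpa using sub_mem h1 h2

theorem coe_hatFib (w : Wick A n) (v : Fock A n) :
    (hatFib g w v : Wick A n) = projV A n (wick g w v) := rfl

theorem hatFib_wick (f h : Wick A n) : hatFib g (wick g f h) = hatFib g f * hatFib g h := by
  ext1 v
  apply Subtype.ext
  rw [Module.End.mul_apply, coe_hatFib, coe_hatFib, coe_hatFib, projV_wick_projV, wick_assoc]

/-- In antiholomorphic directions the connection term carries a factor `ζ̄`, which `Π'` kills, while
on `Π' w` its derivative `∂/∂ζ̄` vanishes. -/
theorem projV_nablaIdx (i : Idx n) (w : Wick A n) :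
    projV A n (nablaIdx d g i w) = nablaIdx d g i (projV A n w) := by
  rcases i with k | l
  · simp only [nablaIdx, Sum.elim_inl, nablaHol_apply, map_sub, map_sum, projV_mul, projV_ofFn,
      projV_of_mem (fock_fibVar _), projV_baseOp, projV_fibDeriv_inl]
  · simp only [nablaIdx, Sum.elim_inr, nablaBar_apply, map_sub, map_sum, projV_mul,
      projV_fibVar_inr, projV_baseOp, fibDeriv_inr_of_mem _ (projV_mem w), mul_zero, zero_mul,
      Finset.sum_const_zero]

theorem coe_nablaHatIdx (i : Idx n) (v : Fock A n) :
    (nablaHatIdx d g i v : Wick A n) = nablaIdx d g i v := by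
  rcases i with k | l
  · rfl
  · change baseOp n (d (Sum.inr l)) v = nablaBar d g l v
    simp only [nablaBar_apply, fibDeriv_inr_of_mem _ v.2, mul_zero, Finset.sum_const_zero,
      sub_zero]

/-- Apply `Π'` to the Leibniz rule for `∇_i (w ∘ v)`; `∇̂_i` is the restriction of `∇_i` and `Π'`
commutes with it. -/
theorem IsKahlerData.nablaHatIdx_mul_hatFib (H : IsKahlerData d g) (i : Idx n) (w : Wick A n) :
    nablaHatIdx d g i * hatFib g w =
      hatFib g (nablaIdx d g i w) + hatFib g w * nablaHatIdx d g i := by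
  ext1 v
  apply Subtype.ext
  rw [LinearMap.add_apply, Submodule.coe_add, Module.End.mul_apply, Module.End.mul_apply,
    coe_nablaHatIdx, coe_hatFib, coe_hatFib, coe_hatFib, coe_nablaHatIdx, ← projV_nablaIdx,
    H.nablaIdx_wick, map_add]

/-- Multiplication by `1/ν` on the Fock space. -/
def nuInvFib (A : Type) [CommRing A] [Algebra ℂ A] (n : ℕ) : Module.End ℂ (Fock A n) :=
  scalarMulFib A n (HahnSeries.single (-1) 1)

theorem ofFormalFn_single (N : ℤ) (a : A) :
    ofFormalFn n (HahnSeries.single N a) = ofFn n a * nuPow A n N := by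
  rw [ofFormalFn, liftNu_single, ofFn, nuPow, HahnSeries.C_apply, HahnSeries.single_mul_single,
    zero_add, mul_one]
  rfl

theorem coe_nuInvFib (v : Fock A n) :
    (nuInvFib A n v : Wick A n) = nuPow A n (-1) * v := by
  change ofFormalFn n (HahnSeries.single (-1) 1) * (v : Wick A n) = _
  rw [ofFormalFn_single, ofFn_one, one_mul]

theorem hatFib_nuPow_mul (w : Wick A n) :
    hatFib g (nuPow A n (-1) * w) = nuInvFib A n * hatFib g w := by
  ext1 v
  apply Subtype.ext
  rw [Module.End.mul_apply, coe_nuInvFib, coe_hatFib, coe_hatFib,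
    wick_const_mul_left (fibDeriv_nuPow · _), projV_nuPow_mul]

theorem hatFib_commute_nuInvFib (w : Wick A n) : Commute (hatFib g w) (nuInvFib A n) := by
  refine LinearMap.ext fun v => Subtype.ext ?_
  rw [Module.End.mul_apply, Module.End.mul_apply, coe_nuInvFib, coe_hatFib, coe_hatFib,
    coe_nuInvFib, wick_const_mul_right (fibDeriv_nuPow · _), projV_nuPow_mul]

theorem nablaHatIdx_commute_nuInvFib (i : Idx n) :
    Commute (nablaHatIdx d g i) (nuInvFib A n) := by
  refine LinearMap.ext fun v => Subtype.ext ?_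
  rw [Module.End.mul_apply, Module.End.mul_apply, coe_nuInvFib, coe_nablaHatIdx, coe_nablaHatIdx,
    coe_nuInvFib, nablaIdx_nuPow_mul]

/-! ### The element `ϑ` -/

variable (g) in
/-- The components of `ϑ`. -/
def thetaIdx : Idx n → Wick A n :=
  Sum.elim (fun k => ∑ l, ofFn n (g k l) * fibVar A (Sum.inr l))
    (fun l => -∑ k, ofFn n (g k l) * fibVar A (Sum.inl k))

@[simp]
theorem fibDeriv_inl_thetaIdx_inl (k p : Fin n) :
    fibDeriv A (Sum.inl k) (thetaIdx g (Sum.inl p)) = 0 := by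
  simp [thetaIdx, fibDeriv_ofFn_mul]

@[simp]
theorem fibDeriv_inr_thetaIdx_inl (l p : Fin n) :
    fibDeriv A (Sum.inr l) (thetaIdx g (Sum.inl p)) = ofFn n (g p l) := by
  simp [thetaIdx, fibDeriv_ofFn_mul]

@[simp]
theorem fibDeriv_inl_thetaIdx_inr (k q : Fin n) :
    fibDeriv A (Sum.inl k) (thetaIdx g (Sum.inr q)) = -ofFn n (g k q) := by
  simp [thetaIdx, fibDeriv_ofFn_mul]

@[simp]
theorem fibDeriv_inr_thetaIdx_inr (l q : Fin n) :
    fibDeriv A (Sum.inr l) (thetaIdx g (Sum.inr q)) = 0 := by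
  simp [thetaIdx, fibDeriv_ofFn_mul]

namespace IsKahlerData

variable (H : IsKahlerData d g)
include H

/-- The commutator with `ϑ` is `ν δ`. -/
theorem wick_thetaIdx_sub (i : Idx n) (w : Wick A n) :
    wick g (thetaIdx g i) w - wick g w (thetaIdx g i) = nuPow A n 1 * fibDeriv A i w := by
  rcases i with p | q
  -- `ϑ_p` is linear in `ζ̄` and free of `ζ`: one product has a single correction, the other none.
  -- The matrix `g` in `ϑ` then cancels the `g⁻¹` of the contraction.
  · rw [wick_of_fibDeriv_inr_inr_eq_zero g (by simp),
      wick_of_fibDeriv_inl_inl_eq_zero g _ (by simp)]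
    simp only [fibDeriv_inr_thetaIdx_inl, fibDeriv_inl_thetaIdx_inl, mul_zero,
      Finset.sum_const_zero, add_zero]
    rw [mul_comm w, add_sub_cancel_left, Finset.sum_comm]
    congr 1
    simp only [← mul_assoc, ← ofFn_mul, mul_comm (g⁻¹ _ _), ← Finset.sum_mul, ← ofFn_sum,
      H.mul_inv_apply]
    rw [Finset.sum_eq_single p]
    · simp [ofFn_one]
    · intro b _ hb
      simp [Ne.symm hb, ofFn_zero]
    · simp
  · rw [wick_of_fibDeriv_inr_inr_eq_zero g (by simp),
      wick_of_fibDeriv_inl_inl_eq_zero g _ (by simp)]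
    simp only [fibDeriv_inr_thetaIdx_inr, fibDeriv_inl_thetaIdx_inr, mul_zero, zero_mul,
      Finset.sum_const_zero, add_zero]
    rw [mul_comm w, sub_add_cancel_left, ← mul_neg]
    congr 1
    simp only [mul_neg, Finset.sum_neg_distrib, neg_neg, mul_left_comm (ofFn n (g⁻¹ _ _)),
      ← ofFn_mul, ← Finset.mul_sum, ← ofFn_sum, H.inv_mul_apply]
    rw [Finset.sum_eq_single q]
    · simp [ofFn_one]
    · intro b _ hb
      simp [hb, ofFn_zero]
    · simp

theorem nablaIdx_inl_fibVar_inl (k j : Fin n) : nablaIdx d g (Sum.inl k) (fibVar A (Sum.inl j)) =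
    -∑ i, ofFn n (christoffel d g j k i) * fibVar A (Sum.inl i) := by
  simp only [nablaIdx, Sum.elim_inl, nablaHol_apply, baseOp_fibVar (H.leibniz _),
    fibDeriv_fibVar_inl_inl, mul_ite, mul_one, mul_zero, zero_sub]
  rw [Finset.sum_comm]
  simp

theorem nablaIdx_inl_fibVar_inr (k j : Fin n) :
    nablaIdx d g (Sum.inl k) (fibVar A (Sum.inr j)) = 0 := by
  simp [nablaIdx, nablaHol_apply, baseOp_fibVar (H.leibniz _)]

theorem nablaIdx_inr_fibVar_inl (k j : Fin n) :
    nablaIdx d g (Sum.inr k) (fibVar A (Sum.inl j)) = 0 := by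
  simp [nablaIdx, nablaBar_apply, baseOp_fibVar (H.leibniz _)]

theorem nablaIdx_inr_fibVar_inr (k j : Fin n) : nablaIdx d g (Sum.inr k) (fibVar A (Sum.inr j)) =
    -∑ i, ofFn n (christoffelBar d g j k i) * fibVar A (Sum.inr i) := by
  simp only [nablaIdx, Sum.elim_inr, nablaBar_apply, baseOp_fibVar (H.leibniz _),
    fibDeriv_fibVar_inr_inr, mul_ite, mul_one, mul_zero, zero_sub]
  rw [Finset.sum_comm]
  simp

theorem sum_mul_christoffel (k i q : Fin n) :
    ∑ s, g s q * christoffel d g s k i = d (Sum.inl k) (g i q) := by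
  simp only [H.christoffel_eq, Finset.mul_sum]
  rw [Finset.sum_comm, Finset.sum_eq_single q]
  · simp only [mul_left_comm (g _ q)]
    simp only [← mul_assoc, ← Finset.sum_mul, H.inv_mul_apply, if_true, one_mul]
  · intro b _ hb
    simp only [mul_left_comm (g _ q)]
    simp only [← mul_assoc, ← Finset.sum_mul, H.inv_mul_apply, if_neg hb,
      zero_mul]
  · simp

theorem sum_mul_christoffelBar (l j p : Fin n) :
    ∑ t, g p t * christoffelBar d g t l j = d (Sum.inr l) (g p j) := by
  simp only [H.christoffelBar_eq, Finset.mul_sum]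
  rw [Finset.sum_comm, Finset.sum_eq_single p]
  · simp only [← mul_assoc, ← Finset.sum_mul, H.mul_inv_apply, if_true, one_mul]
  · intro b _ hb
    simp only [← mul_assoc, ← Finset.sum_mul, H.mul_inv_apply, if_neg (Ne.symm hb), zero_mul]
  · simp

/-- The metric is parallel: the derivative of `g` cancels the Christoffel term coming from `ζ^k`. -/
theorem nablaIdx_thetaIdx_inl_inr (k q : Fin n) :
    nablaIdx d g (Sum.inl k) (thetaIdx g (Sum.inr q)) = 0 := by
  simp only [thetaIdx, Sum.elim_inr, map_neg, map_sum, H.nablaIdx_leibniz, nablaIdx_ofFn,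
    H.nablaIdx_inl_fibVar_inl, mul_neg, Finset.sum_add_distrib, Finset.sum_neg_distrib,
    Finset.mul_sum]
  rw [Finset.sum_comm (f := fun x i => ofFn n (g x q) * _)]
  simp only [← mul_assoc, ← ofFn_mul, ← Finset.sum_mul, ← ofFn_sum, H.sum_mul_christoffel]
  simp

theorem nablaIdx_thetaIdx_inr_inl (l p : Fin n) :
    nablaIdx d g (Sum.inr l) (thetaIdx g (Sum.inl p)) = 0 := by
  simp only [thetaIdx, Sum.elim_inl, map_sum, H.nablaIdx_leibniz, nablaIdx_ofFn,
    H.nablaIdx_inr_fibVar_inr, mul_neg, Finset.sum_add_distrib, Finset.sum_neg_distrib,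
    Finset.mul_sum]
  rw [Finset.sum_comm (f := fun x i => ofFn n (g p x) * _)]
  simp only [← mul_assoc, ← ofFn_mul, ← Finset.sum_mul, ← ofFn_sum, H.sum_mul_christoffelBar]
  simp

/-- The Kähler connection annihilates `ϑ`. -/
theorem nablaIdx_thetaIdx_comm (i j : Idx n) :
    nablaIdx d g i (thetaIdx g j) = nablaIdx d g j (thetaIdx g i) := by
  rcases i with p | p <;> rcases j with q | q
  -- For equal types the components need not vanish: only `∂_p g_{ql} ζ̄^l` is left, and it is
  -- symmetric in `p`, `q` by closedness of the Kähler form.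
  · simp only [thetaIdx, Sum.elim_inl, map_sum, H.nablaIdx_leibniz, nablaIdx_ofFn,
      H.nablaIdx_inl_fibVar_inr, H.hol p, mul_zero]
  · rw [H.nablaIdx_thetaIdx_inl_inr, H.nablaIdx_thetaIdx_inr_inl]
  · rw [H.nablaIdx_thetaIdx_inl_inr, H.nablaIdx_thetaIdx_inr_inl]
  · simp only [thetaIdx, Sum.elim_inr, map_neg, map_sum, H.nablaIdx_leibniz, nablaIdx_ofFn,
      H.nablaIdx_inr_fibVar_inl, H.bar p _ q, mul_zero]

end IsKahlerData

end Connection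

/-! ## Curvature of the Kähler connection on the Fock space -/

section Curvature

variable {A : Type} [CommRing A] [Algebra ℂ A] {n : ℕ}

/-- The operator `∑ G_{si} ζ^i ∂/∂ζ^s`. -/
def linVectorField (G : Matrix (Fin n) (Fin n) A) (w : Wick A n) : Wick A n :=
  ∑ s, ∑ i, ofFn n (G s i) * fibVar A (Sum.inl i) * fibDeriv A (Sum.inl s) w

theorem linVectorField_add (G G' : Matrix (Fin n) (Fin n) A) (w : Wick A n) :
    linVectorField (G + G') w = linVectorField G w + linVectorField G' w := by
  simp only [linVectorField, Matrix.add_apply, ofFn_add, add_mul, Finset.sum_add_distrib]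

theorem baseOp_linVectorField {φ : A →ₗ[ℂ] A} (hφ : ∀ x y, φ (x * y) = φ x * y + x * φ y)
    (G : Matrix (Fin n) (Fin n) A) (w : Wick A n) : baseOp n φ (linVectorField G w) =
      linVectorField (G.map φ) w + linVectorField G (baseOp n φ w) := by
  simp only [linVectorField, map_sum, baseOp_leibniz hφ, baseOp_ofFn, baseOp_fibVar hφ, mul_zero,
    add_zero, Finset.sum_add_distrib, baseOp_fibDeriv, Matrix.map_apply]

/-- The second-order part is symmetric under exchanging `G` and `G'`, so only the first-order part,
with the matrices in reversed order, enters the commutator. -/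
theorem linVectorField_linVectorField (G G' : Matrix (Fin n) (Fin n) A) (w : Wick A n) :
    linVectorField G (linVectorField G' w) = linVectorField (G' * G) w +
      ∑ s, ∑ i, ∑ t, ∑ j, ofFn n (G s i) * ofFn n (G' t j) * fibVar A (Sum.inl i) *
        fibVar A (Sum.inl j) * fibDeriv A (Sum.inl s) (fibDeriv A (Sum.inl t) w) := by
  have h : ∀ s, fibDeriv A (Sum.inl s) (linVectorField G' w) =
      ∑ t, ofFn n (G' t s) * fibDeriv A (Sum.inl t) w + ∑ t, ∑ j, ofFn n (G' t j) *
        fibVar A (Sum.inl j) * fibDeriv A (Sum.inl s) (fibDeriv A (Sum.inl t) w) := fun s => by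
    simp [linVectorField, fibDeriv_leibniz, Finset.sum_add_distrib]
  rw [linVectorField]
  simp only [h, mul_add, Finset.sum_add_distrib, Finset.mul_sum]
  refine congrArg₂ (· + ·) ?_ ?_
  · simp only [linVectorField, Matrix.mul_apply, ofFn_sum, ofFn_mul, Finset.sum_mul]
    rw [Finset.sum_congr rfl fun _ _ => Finset.sum_comm, Finset.sum_comm]
    refine Finset.sum_congr rfl fun _ _ => ?_
    rw [Finset.sum_comm]
    exact Finset.sum_congr rfl fun _ _ => Finset.sum_congr rfl fun _ _ => by ring
  · exact Finset.sum_congr rfl fun _ _ => Finset.sum_congr rfl fun _ _ =>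
      Finset.sum_congr rfl fun _ _ => Finset.sum_congr rfl fun _ _ => by ring

theorem linVectorField_commutator (G G' : Matrix (Fin n) (Fin n) A) (w : Wick A n) :
    linVectorField G (linVectorField G' w) + linVectorField (G * G') w =
      linVectorField G' (linVectorField G w) + linVectorField (G' * G) w := by
  rw [linVectorField_linVectorField, linVectorField_linVectorField]
  have h : ∑ s, ∑ i, ∑ t, ∑ j, ofFn n (G s i) * ofFn n (G' t j) * fibVar A (Sum.inl i) *
        fibVar A (Sum.inl j) * fibDeriv A (Sum.inl s) (fibDeriv A (Sum.inl t) w) =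
      ∑ s, ∑ i, ∑ t, ∑ j, ofFn n (G' s i) * ofFn n (G t j) * fibVar A (Sum.inl i) *
        fibVar A (Sum.inl j) * fibDeriv A (Sum.inl s) (fibDeriv A (Sum.inl t) w) := by
    rw [Finset.sum_congr rfl fun _ _ => Finset.sum_comm, Finset.sum_comm]
    refine Finset.sum_congr rfl fun s _ => ?_
    rw [Finset.sum_congr rfl fun _ _ => Finset.sum_comm, Finset.sum_comm]
    refine Finset.sum_congr rfl fun i _ => Finset.sum_congr rfl fun t _ =>
      Finset.sum_congr rfl fun j _ => ?_
    rw [fibDeriv_comm]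
    ring
  rw [h]
  abel

variable (d : Idx n → A →ₗ[ℂ] A) (g : Matrix (Fin n) (Fin n) A)

/-- The matrix of Christoffel symbols in the direction of a holomorphic coordinate. -/
def christoffelMatrix (p : Fin n) : Matrix (Fin n) (Fin n) A :=
  Matrix.of fun s i => christoffel d g s p i

/-- The coefficients of the curvature `R`. -/
def curvCoeff (k l p q : Fin n) : A :=
  -(∑ t, ∑ s, g⁻¹ t s * d (Sum.inl p) (g k t) * d (Sum.inr q) (g s l)) +
    d (Sum.inl p) (d (Sum.inr q) (g k l))

/-- The components of the curvature `R`, viewed as a 2-form. -/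
def curvIdx : Idx n → Idx n → Wick A n
  | Sum.inl p, Sum.inr q => ∑ k, ∑ l,
      ofFn n (curvCoeff d g k l p q) * fibVar A (Sum.inl k) * fibVar A (Sum.inr l)
  | _, _ => 0

variable {d g}

theorem nablaHol_eq (p : Fin n) (w : Wick A n) : nablaHol d g p w =
    baseOp n (d (Sum.inl p)) w - linVectorField (christoffelMatrix d g p) w :=
  nablaHol_apply d g p w

theorem fibDeriv_curvIdx (l p q : Fin n) :
    fibDeriv A (Sum.inr l) (curvIdx d g (Sum.inl p) (Sum.inr q)) =
      ∑ k, ofFn n (curvCoeff d g k l p q) * fibVar A (Sum.inl k) := by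
  simp [curvIdx, fibDeriv_leibniz]

theorem projV_curvIdx (i j : Idx n) : projV A n (curvIdx d g i j) = 0 := by
  rcases i with p | p <;> rcases j with q | q
  · exact map_zero _
  · simp [curvIdx, projV_mul, projV_fibVar_inr]
  · exact map_zero _
  · exact map_zero _

namespace IsKahlerData

variable (H : IsKahlerData d g)
include H

theorem christoffelMatrix_eq (p : Fin n) :
    christoffelMatrix d g p = (g.map (d (Sum.inl p)) * g⁻¹).transpose := by
  ext s i
  simp only [christoffelMatrix, Matrix.of_apply, H.christoffel_eq, Matrix.transpose_apply,
    Matrix.mul_apply, Matrix.map_apply]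
  exact Finset.sum_congr rfl fun _ _ => mul_comm _ _

/-- With `Γ_p = (∂_p g · g⁻¹)ᵀ`, the sum `∂_p Γ_q + Γ_p Γ_q` involves only `∂_p ∂_q g` and is
symmetric in `p`, `q`. Hence the curvature has no part of type (2,0). -/
theorem map_christoffelMatrix (p q : Fin n) : (christoffelMatrix d g q).map (d (Sum.inl p)) =
    ((g.map (d (Sum.inl q))).map (d (Sum.inl p)) * g⁻¹).transpose -
      christoffelMatrix d g p * christoffelMatrix d g q := by
  rw [H.christoffelMatrix_eq, H.christoffelMatrix_eq, Matrix.transpose_map,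
    map_matrix_mul (H.leibniz _), map_matrix_inv (H.leibniz _) H.isUnit_det,
    ← Matrix.transpose_mul, ← Matrix.transpose_sub]
  congr 1
  rw [Matrix.mul_neg, ← sub_eq_add_neg]
  simp only [Matrix.mul_assoc]

theorem nablaHol_comm (p q : Fin n) (w : Wick A n) :
    nablaHol d g p (nablaHol d g q w) = nablaHol d g q (nablaHol d g p w) := by
  simp only [nablaHol_eq, map_sub, baseOp_linVectorField (H.leibniz _)]
  have h1 := linVectorField_commutator (christoffelMatrix d g p) (christoffelMatrix d g q) w
  have h2 : (christoffelMatrix d g q).map (d (Sum.inl p)) +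
      christoffelMatrix d g p * christoffelMatrix d g q =
      (christoffelMatrix d g p).map (d (Sum.inl q)) +
      christoffelMatrix d g q * christoffelMatrix d g p := by
    rw [H.map_christoffelMatrix, H.map_christoffelMatrix, sub_add_cancel, sub_add_cancel]
    congr 2
    ext a b
    exact H.comm _ _ _
  have h3 := congrArg (linVectorField · w) h2
  simp only [linVectorField_add] at h3
  rw [baseOp_comm (H.comm (Sum.inl p) (Sum.inl q))]
  linear_combination h1 - h3

/-- The term of `R` quadratic in first derivatives of `g` comes from differentiating `g⁻¹`, the
other term from `∂_p g_{kl}`. -/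
theorem map_christoffel (s p k q : Fin n) :
    d (Sum.inr q) (christoffel d g s p k) = ∑ l, g⁻¹ l s * curvCoeff d g k l p q := by
  rw [H.christoffel_eq, map_sum]
  simp only [H.leibniz, Finset.sum_add_distrib, curvCoeff, mul_add, H.comm (Sum.inr q)]
  congr 1
  simp only [H.map_inv, neg_mul, mul_neg, Finset.sum_neg_distrib, Finset.sum_mul, Finset.mul_sum]
  congr 1
  rw [Finset.sum_comm]
  refine Finset.sum_congr rfl fun _ _ => Finset.sum_congr rfl fun _ _ =>
    Finset.sum_congr rfl fun _ _ => by ring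

theorem map_christoffelMatrix_inr (p q : Fin n) :
    (christoffelMatrix d g p).map (d (Sum.inr q)) =
      Matrix.of fun s k => ∑ l, g⁻¹ l s * curvCoeff d g k l p q := by
  ext s k
  exact H.map_christoffel s p k q

/-- `R` is linear in `ζ̄`: the pointwise product dies under `Π'`, and the single contraction carries
a `ν` that cancels `ν⁻¹`. What is left is a vector field with coefficients `∂̄Γ`. -/
theorem nuInvFib_mul_hatFib_curvIdx (p q : Fin n) (v : Fock A n) :
    ((nuInvFib A n * hatFib g (curvIdx d g (Sum.inl p) (Sum.inr q))) v : Wick A n) =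
      linVectorField ((christoffelMatrix d g p).map (d (Sum.inr q))) v := by
  rw [Module.End.mul_apply, coe_nuInvFib, coe_hatFib, wick_of_fibDeriv_inr_inr_eq_zero, map_add,
    projV_mul, projV_curvIdx, zero_mul, zero_add, projV_nuPow_mul, ← mul_assoc, nuPow_mul,
    show (-1 + 1 : ℤ) = 0 by norm_num, nuPow_zero, one_mul, H.map_christoffelMatrix_inr]
  · simp only [fibDeriv_curvIdx, map_sum, projV_mul, projV_ofFn, projV_of_mem (fock_fibVar _),
      projV_of_mem (fock_fibDeriv _ v.2), linVectorField, Matrix.of_apply, ofFn_sum, ofFn_mul,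
      Finset.sum_mul, Finset.mul_sum]
    rw [Finset.sum_comm]
    refine Finset.sum_congr rfl fun s _ => ?_
    rw [Finset.sum_comm]
    exact Finset.sum_congr rfl fun _ _ => Finset.sum_congr rfl fun _ _ => by ring
  · intro l l'
    simp [fibDeriv_curvIdx, fibDeriv_ofFn_mul]

/-- The curvature of the Kähler connection on the Fock space. -/
theorem nablaHatIdx_commutator (i j : Idx n) :
    nablaHatIdx d g i * nablaHatIdx d g j + nuInvFib A n * hatFib g (curvIdx d g j i) =
      nablaHatIdx d g j * nablaHatIdx d g i + nuInvFib A n * hatFib g (curvIdx d g i j) := by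
  -- `∇̂` is plain `∂̄` in antiholomorphic directions, so the mixed commutator differentiates the
  -- Christoffel symbols only. Components of equal type commute.
  have mixed : ∀ p q : Fin n, nablaHatIdx d g (Sum.inl p) * nablaHatIdx d g (Sum.inr q) =
      nablaHatIdx d g (Sum.inr q) * nablaHatIdx d g (Sum.inl p) +
      nuInvFib A n * hatFib g (curvIdx d g (Sum.inl p) (Sum.inr q)) := fun p q => by
    refine LinearMap.ext fun v => Subtype.ext ?_
    rw [LinearMap.add_apply, Submodule.coe_add, H.nuInvFib_mul_hatFib_curvIdx]
    change nablaHol d g p (baseOp n (d (Sum.inr q)) v) =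
      baseOp n (d (Sum.inr q)) (nablaHol d g p v) + _
    simp only [nablaHol_eq, map_sub, baseOp_linVectorField (H.leibniz _)]
    rw [baseOp_comm (H.comm (Sum.inr q) (Sum.inl p))]
    abel
  rcases i with p | p <;> rcases j with q | q
  · rw [show curvIdx d g (Sum.inl p) (Sum.inl q) = 0 from rfl,
      show curvIdx d g (Sum.inl q) (Sum.inl p) = 0 from rfl]
    congr 1
    exact LinearMap.ext fun v => Subtype.ext (H.nablaHol_comm p q v)
  · rw [mixed, show curvIdx d g (Sum.inr q) (Sum.inl p) = 0 from rfl, map_zero, mul_zero, add_zero]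
  · rw [mixed, show curvIdx d g (Sum.inr p) (Sum.inl q) = 0 from rfl, map_zero, mul_zero, add_zero]
  · rw [show curvIdx d g (Sum.inr p) (Sum.inr q) = 0 from rfl,
      show curvIdx d g (Sum.inr q) (Sum.inr p) = 0 from rfl]
    congr 1
    exact LinearMap.ext fun v =>
      Subtype.ext (baseOp_comm (H.comm (Sum.inr p) (Sum.inr q)) (v : Wick A n))

end IsKahlerData

/-! ### The commutators of the components of `D̂` -/

variable (d g) in
/-- The components of `D̂` for `γ = -ϑ + r`. -/
def dHatIdx (r : Idx n → Wick A n) (i : Idx n) : Module.End ℂ (Fock A n) :=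
  nablaHatIdx d g i + nuInvFib A n * hatFib g (-thetaIdx g i + r i)

variable (d g) in
/-- The components of `∇ r - δ r + (1/ν) r ∘ r`. -/
def fedosovIdx (r : Idx n → Wick A n) (i j : Idx n) : Wick A n :=
  nablaIdx d g i (r j) - fibDeriv A i (r j) + nuPow A n (-1) * wick g (r i) (r j)

namespace IsKahlerData

variable (H : IsKahlerData d g)
include H

/-- The last bracket collects the terms still containing a derivative on the right; it is symmetric
in `i`, `j` and disappears from the commutator. -/
theorem dHatIdx_mul_dHatIdx (r : Idx n → Wick A n) (i j : Idx n) :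
    dHatIdx d g r i * dHatIdx d g r j = nablaHatIdx d g i * nablaHatIdx d g j +
      nuInvFib A n * hatFib g (nablaIdx d g i (-thetaIdx g j + r j) +
        nuPow A n (-1) * wick g (-thetaIdx g i + r i) (-thetaIdx g j + r j)) +
      (nuInvFib A n * (hatFib g (-thetaIdx g j + r j) * nablaHatIdx d g i) +
        nuInvFib A n * (hatFib g (-thetaIdx g i + r i) * nablaHatIdx d g j)) := by
  simp only [dHatIdx]
  generalize -thetaIdx g i + r i = x
  generalize -thetaIdx g j + r j = y
  have h1 : nablaHatIdx d g i * (nuInvFib A n * hatFib g y) =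
      nuInvFib A n * (nablaHatIdx d g i * hatFib g y) := by
    rw [← mul_assoc, (nablaHatIdx_commute_nuInvFib i).eq, mul_assoc]
  have h2 : nuInvFib A n * hatFib g x * (nuInvFib A n * hatFib g y) =
      nuInvFib A n * (nuInvFib A n * (hatFib g x * hatFib g y)) := by
    rw [mul_assoc, ← mul_assoc (hatFib g x), (hatFib_commute_nuInvFib x).eq, mul_assoc]
  rw [add_mul, mul_add, mul_add, h1, h2, map_add, hatFib_nuPow_mul, hatFib_wick,
    H.nablaHatIdx_mul_hatFib, mul_add, mul_add, mul_assoc (nuInvFib A n) (hatFib g x)]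
  abel

/-- Modulo terms symmetric in `i`, `j`: `∇ϑ` drops out, the cross terms of `ν⁻¹ γ ∘ γ` give `-δr`,
and `ν⁻¹ [ϑ_i, ϑ_j]` is `∂_i ϑ_j`. Both sides are arranged to avoid subtraction. -/
theorem nablaIdx_gamma_add_wick_gamma (r : Idx n → Wick A n) (i j : Idx n) :
    nablaIdx d g i (-thetaIdx g j + r j) +
        nuPow A n (-1) * wick g (-thetaIdx g i + r i) (-thetaIdx g j + r j) +
        fedosovIdx d g r j i =
      nablaIdx d g j (-thetaIdx g i + r i) +
        nuPow A n (-1) * wick g (-thetaIdx g j + r j) (-thetaIdx g i + r i) +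
        (fibDeriv A i (thetaIdx g j) + fedosovIdx d g r i j) := by
  have hν : nuPow A n (-1) * nuPow A n 1 = 1 := by
    rw [nuPow_mul, show (-1 + 1 : ℤ) = 0 by norm_num, nuPow_zero]
  have e1 := H.wick_thetaIdx_sub i (thetaIdx g j)
  have e2 := H.wick_thetaIdx_sub i (r j)
  have e3 := H.wick_thetaIdx_sub j (r i)
  simp only [fedosovIdx, map_add, map_neg, LinearMap.add_apply, LinearMap.neg_apply,
    H.nablaIdx_thetaIdx_comm i j]
  -- The second summand clears the products `ν⁻¹ ν` that the three commutators leave behind.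
  linear_combination nuPow A n (-1) * (e1 - e2 + e3) +
    (fibDeriv A i (thetaIdx g j) - fibDeriv A i (r j) + fibDeriv A j (r i)) * hν

omit H in
theorem add_add_add_eq_of_eq {M : Type*} [AddCommMonoid M] {a a' x x' s s' c c' q q' t : M}
    (h1 : a + c' = a' + c) (h2 : x + q' = x' + (t + q)) :
    a + x + (s + s') + (c' + q') = a' + x' + (s' + s) + (c + q) + t := by
  calc _ = (a + c') + (x + q') + (s + s') := by abel
    _ = _ := by rw [h1, h2]; abel

/-- The curvature of `D̂` in components. -/
theorem dHatIdx_commutator (r : Idx n → Wick A n) (i j : Idx n) :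
    dHatIdx d g r i * dHatIdx d g r j +
        nuInvFib A n * hatFib g (curvIdx d g j i + fedosovIdx d g r j i) =
      dHatIdx d g r j * dHatIdx d g r i +
        nuInvFib A n * hatFib g (curvIdx d g i j + fedosovIdx d g r i j) +
        nuInvFib A n * hatFib g (fibDeriv A i (thetaIdx g j)) := by
  have h1 := H.nablaHatIdx_commutator i j
  have h2 := congrArg (fun x => nuInvFib A n * hatFib g x)
    (H.nablaIdx_gamma_add_wick_gamma r i j)
  have split : ∀ x y : Wick A n, nuInvFib A n * hatFib g (x + y) =
      nuInvFib A n * hatFib g x + nuInvFib A n * hatFib g y := fun x y => by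
    rw [map_add, mul_add]
  rw [H.dHatIdx_mul_dHatIdx, H.dHatIdx_mul_dHatIdx, split (curvIdx d g j i),
    split (curvIdx d g i j)]
  simp only [split _ (fedosovIdx d g r j i), split _ (_ + fedosovIdx d g r i j),
    split _ (fedosovIdx d g r i j)] at h2
  exact add_add_add_eq_of_eq h1 h2

end IsKahlerData

end Curvature

/-! ## Operators on Fock-space valued forms -/

section Forms

variable {A : Type} [CommRing A] [Algebra ℂ A] {n : ℕ}

theorem dx_mul_dx_comm (i j : Idx n) : dx i * dx j = -(dx j * dx i) :=
  eq_neg_of_add_eq_zero_left (ExteriorAlgebra.ι_add_mul_swap _ _)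

theorem wedge_comp_wedge_comm (i j : Idx n) :
    wedge i ∘ₗ wedge j = -(wedge j ∘ₗ wedge i : Ext n →ₗ[ℂ] Ext n) := by
  refine LinearMap.ext fun x => ?_
  change dx i * (dx j * x) = -(dx j * (dx i * x))
  rw [← mul_assoc, ← mul_assoc, dx_mul_dx_comm, neg_mul]

/-- The operator `∑ S_{ij} dx^i ∧ dx^j` on Fock-space valued forms. -/
def twoFormOp (S : Idx n → Idx n → Module.End ℂ (Fock A n)) : Module.End ℂ (FockForms A n) :=
  ∑ i, ∑ j, TensorProduct.map (S i j) (wedge i ∘ₗ wedge j)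

theorem twoFormOp_add (S S' : Idx n → Idx n → Module.End ℂ (Fock A n)) :
    twoFormOp (fun i j => S i j + S' i j) = twoFormOp S + twoFormOp S' := by
  simp only [twoFormOp, TensorProduct.map_add_left, Finset.sum_add_distrib]

theorem map_neg_right_add_map {V : Type*} [AddCommMonoid V] [Module ℂ V] (f : V →ₗ[ℂ] V)
    (h : Ext n →ₗ[ℂ] Ext n) : TensorProduct.map f (-h) + TensorProduct.map f h = 0 := by
  rw [← TensorProduct.map_add_right, neg_add_cancel]
  exact TensorProduct.ext' fun x y => by simp

/-- Exchanging the indices of the coefficients amounts to exchanging the two wedge operators, which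
anticommute. -/
theorem twoFormOp_add_swap (S : Idx n → Idx n → Module.End ℂ (Fock A n)) :
    twoFormOp S + twoFormOp (fun i j => S j i) = 0 := by
  simp only [twoFormOp]
  rw [Finset.sum_comm (f := fun i j => TensorProduct.map (S j i) _), ← Finset.sum_add_distrib]
  refine Finset.sum_eq_zero fun i _ => ?_
  rw [← Finset.sum_add_distrib]
  refine Finset.sum_eq_zero fun j _ => ?_
  rw [wedge_comp_wedge_comm]
  exact map_neg_right_add_map _ _

/-- An operator `∑ S_{ij} dx^i ∧ dx^j` only depends on the antisymmetric part of `S`. -/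
theorem twoFormOp_eq_of_add_swap {S S' : Idx n → Idx n → Module.End ℂ (Fock A n)}
    (h : ∀ i j, S i j + S' j i = S j i + S' i j) : twoFormOp S = twoFormOp S' := by
  have h1 : twoFormOp S + twoFormOp (fun i j => S' j i) =
      twoFormOp (fun i j => S j i) + twoFormOp S' := by
    rw [← twoFormOp_add, ← twoFormOp_add]
    congr 1
    funext i j
    exact h i j
  have h2 := twoFormOp_add_swap S
  have h3 := twoFormOp_add_swap S'
  refine LinearMap.ext fun x => ?_
  have e1 := LinearMap.congr_fun h1 x
  have e2 := LinearMap.congr_fun h2 x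
  have e3 := LinearMap.congr_fun h3 x
  simp only [LinearMap.add_apply, LinearMap.zero_apply] at e1 e2 e3
  generalize twoFormOp S x = a at *
  generalize twoFormOp S' x = b at *
  generalize twoFormOp (fun i j => S j i) x = a' at *
  generalize twoFormOp (fun i j => S' j i) x = b' at *
  -- `e2` and `e3` say `a' = -a` and `b' = -b`, so `e1` becomes `a - b = b - a`; dividing by two is
  -- possible over `ℂ`.
  have e : a + a = b + b := by
    calc a + a = a + a + (b + b') := by rw [e3, add_zero]
      _ = a + b + (a + b') := by abel
      _ = a + a' + (b + b) := by rw [e1]; abel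
      _ = b + b := by rw [e2, zero_add]
  have half : ∀ y : FockForms A n, y = (2 : ℂ)⁻¹ • (y + y) := fun y => by
    rw [← two_smul ℂ, smul_smul, inv_mul_cancel₀ two_ne_zero, one_smul]
  rw [half a, e, ← half b]

/-- No signs appear: the coefficients act on the Fock factor and the wedges on the exterior factor.
-/
theorem sum_map_wedge_mul_self (T : Idx n → Module.End ℂ (Fock A n)) :
    (∑ i, TensorProduct.map (T i) (wedge i) : Module.End ℂ (FockForms A n)) *
      (∑ i, TensorProduct.map (T i) (wedge i)) = twoFormOp fun i j => T i * T j := by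
  rw [twoFormOp, Finset.sum_mul_sum]
  refine Finset.sum_congr rfl fun i _ => Finset.sum_congr rfl fun j _ => ?_
  exact (TensorProduct.map_comp _ _ _ _).symm

variable (d : Idx n → A →ₗ[ℂ] A) (g : Matrix (Fin n) (Fin n) A)

theorem nablaHat_eq_sum :
    nablaHat d g = ∑ i, TensorProduct.map (nablaHatIdx d g i) (wedge i) := by
  rw [Fintype.sum_sum_type]
  rfl

theorem nabla_eq_sum : nabla d g = ∑ i, TensorProduct.map (nablaIdx d g i) (wedge i) := by
  rw [Fintype.sum_sum_type]
  rfl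

theorem theta_eq_sum : theta g = ∑ i, thetaIdx g i ⊗ₜ[ℂ] dx i := by
  rw [Fintype.sum_sum_type]
  simp only [theta, thetaIdx, Sum.elim_inl, Sum.elim_inr, TensorProduct.sum_tmul,
    TensorProduct.neg_tmul, Finset.sum_sub_distrib, Finset.sum_neg_distrib]
  rw [Finset.sum_comm (f := fun l k => (ofFn n (g k l) * _) ⊗ₜ[ℂ] _), sub_eq_add_neg]

theorem curvR_eq_sum : curvR d g = ∑ i, ∑ j, curvIdx d g i j ⊗ₜ[ℂ] (dx i * dx j) := by
  simp only [Fintype.sum_sum_type, curvIdx, TensorProduct.zero_tmul, Finset.sum_const_zero,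
    add_zero, zero_add, TensorProduct.sum_tmul]
  simp only [curvR, curvCoeff]
  rw [Finset.sum_congr rfl fun _ _ => Finset.sum_comm, Finset.sum_comm]
  refine Finset.sum_congr rfl fun p _ => ?_
  rw [Finset.sum_congr rfl fun _ _ => Finset.sum_comm, Finset.sum_comm]

theorem hat_tmul_dx (w : Wick A n) (i : Idx n) :
    hat g (w ⊗ₜ dx i) = TensorProduct.map (hatFib g w) (wedge i) :=
  TensorProduct.ext' fun _ _ => rfl

theorem hat_tmul_dx_mul_dx (w : Wick A n) (i j : Idx n) :
    hat g (w ⊗ₜ (dx i * dx j)) = TensorProduct.map (hatFib g w) (wedge i ∘ₗ wedge j) :=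
  TensorProduct.ext' fun v x => by
    change hatFib g w v ⊗ₜ[ℂ] (dx i * dx j * x) = hatFib g w v ⊗ₜ[ℂ] (dx i * (dx j * x))
    rw [mul_assoc]

theorem hat_sum_tmul (x : Idx n → Idx n → Wick A n) :
    hat g (∑ i, ∑ j, x i j ⊗ₜ (dx i * dx j)) = twoFormOp fun i j => hatFib g (x i j) := by
  simp only [map_sum, hat_tmul_dx_mul_dx, twoFormOp]

theorem nuInvFock_eq : nuInvFock A n = TensorProduct.map (nuInvFib A n) LinearMap.id :=
  TensorProduct.ext' fun v x => by
    change nuInvFib A n v ⊗ₜ[ℂ] (1 * x) = nuInvFib A n v ⊗ₜ[ℂ] x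
    rw [one_mul]

theorem dHat_eq_sum (r : Idx n → Wick A n) :
    dHat d g (∑ i, r i ⊗ₜ dx i) = ∑ i, TensorProduct.map (dHatIdx d g r i) (wedge i) := by
  have hγ : gamma g (∑ i, r i ⊗ₜ dx i) = ∑ i, (-thetaIdx g i + r i) ⊗ₜ[ℂ] dx i := by
    simp only [gamma, theta_eq_sum, TensorProduct.add_tmul, TensorProduct.neg_tmul,
      Finset.sum_add_distrib, Finset.sum_neg_distrib]
  rw [dHat, nablaHat_eq_sum, hγ, map_sum, nuInvFock_eq, ← Module.End.mul_eq_comp, Finset.mul_sum,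
    ← Finset.sum_add_distrib]
  refine Finset.sum_congr rfl fun i _ => ?_
  rw [hat_tmul_dx, dHatIdx, TensorProduct.map_add_left, Module.End.mul_eq_comp,
    ← TensorProduct.map_comp]
  rfl

theorem exists_eq_sum_tmul_dx {w : WickForms A n} (hw : w ∈ formsOfDegree A n 1) :
    ∃ r : Idx n → Wick A n, w = ∑ i, r i ⊗ₜ dx i := by
  obtain ⟨t, rfl⟩ := hw
  induction t with
  | zero => exact ⟨0, by simp⟩
  | add x y hx hy =>
    obtain ⟨a, ha⟩ := hx
    obtain ⟨b, hb⟩ := hy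
    exact ⟨a + b, by rw [map_add, ha, hb]; simp [TensorProduct.add_tmul, Finset.sum_add_distrib]⟩
  | tmul x y =>
    obtain ⟨η, hη⟩ := y
    -- An exterior power is a power of the range of `ι`; in degree one this exhibits `η` as a
    -- covector, to be expanded in the standard basis.
    change η ∈ LinearMap.range (ExteriorAlgebra.ι ℂ) ^ 1 at hη
    rw [pow_one] at hη
    obtain ⟨v, rfl⟩ := hη
    refine ⟨fun i => v i • x, ?_⟩
    rw [TensorProduct.map_tmul]
    change x ⊗ₜ[ℂ] ExteriorAlgebra.ι ℂ v = _
    conv_lhs => rw [pi_eq_sum_univ' v]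
    simp only [map_sum, map_smul, TensorProduct.tmul_sum, TensorProduct.smul_tmul, dx]

theorem nuInvWick_circ_tmul (x y : Wick A n) (a b : Ext n) :
    nuInvWick A n (circ g (x ⊗ₜ a) (y ⊗ₜ b)) = (nuPow A n (-1) * wick g x y) ⊗ₜ (a * b) := by
  rw [circ, TensorProduct.map₂_apply_tmul, nuInvWick, TensorProduct.map_tmul]
  rfl

/-- Only the total two-form vanishes; single components need not, as they are not antisymmetrised.
-/
theorem fedosovIdx_of_fedosov_eq {r : Idx n → Wick A n}
    (h : delta A n (∑ i, r i ⊗ₜ dx i) = curvR d g + nabla d g (∑ i, r i ⊗ₜ dx i) +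
      nuInvWick A n (circ g (∑ i, r i ⊗ₜ dx i) (∑ i, r i ⊗ₜ dx i))) :
    ∑ i, ∑ j, (curvIdx d g i j + fedosovIdx d g r i j) ⊗ₜ[ℂ] (dx i * dx j) = 0 := by
  have h1 : delta A n (∑ i, r i ⊗ₜ dx i) =
      ∑ i, ∑ j, fibDeriv A i (r j) ⊗ₜ[ℂ] (dx i * dx j) := by
    simp only [delta, LinearMap.sum_apply, map_sum, TensorProduct.map_tmul]
    exact Finset.sum_comm
  have h2 : nabla d g (∑ i, r i ⊗ₜ dx i) =
      ∑ i, ∑ j, nablaIdx d g i (r j) ⊗ₜ[ℂ] (dx i * dx j) := by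
    simp only [nabla_eq_sum, LinearMap.sum_apply, map_sum, TensorProduct.map_tmul]
    exact Finset.sum_comm
  have h3 : nuInvWick A n (circ g (∑ i, r i ⊗ₜ dx i) (∑ i, r i ⊗ₜ dx i)) =
      ∑ i, ∑ j, (nuPow A n (-1) * wick g (r i) (r j)) ⊗ₜ[ℂ] (dx i * dx j) := by
    simp only [map_sum, LinearMap.sum_apply, nuInvWick_circ_tmul]
    exact Finset.sum_comm
  rw [h1, h2, h3, curvR_eq_sum] at h
  simp only [fedosovIdx, TensorProduct.add_tmul, TensorProduct.sub_tmul, Finset.sum_add_distrib,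
    Finset.sum_sub_distrib]
  rw [h]
  abel

/-- The components of the curvature `i ω`. -/
def scalarCurvIdx : Idx n → Idx n → Module.End ℂ (Fock A n)
  | Sum.inl k, Sum.inr l =>
    scalarMulFib A n (Complex.I • HahnSeries.single (-1) (Complex.I • g k l))
  | _, _ => 0

theorem scalarMul_omegaForm :
    scalarMul A n (Complex.I • omegaForm g) = twoFormOp (scalarCurvIdx g) := by
  simp only [twoFormOp, Fintype.sum_sum_type, scalarCurvIdx, TensorProduct.map_zero_left,
    Finset.sum_const_zero, add_zero, zero_add]
  simp only [omegaForm, kahlerForm, map_sum, Finset.smul_sum]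
  refine Finset.sum_congr rfl fun k _ => Finset.sum_congr rfl fun l _ =>
    TensorProduct.ext' fun v x => ?_
  rw [TensorProduct.map_tmul, TensorProduct.smul_tmul']
  change scalarMulFib A n (Complex.I • HahnSeries.single (-1) (Complex.I • g k l)) v ⊗ₜ[ℂ]
    (dx (Sum.inl k) * dx (Sum.inr l) * x) = scalarMulFib A n (Complex.I •
      HahnSeries.single (-1) (Complex.I • g k l)) v ⊗ₜ[ℂ] (dx (Sum.inl k) * (dx (Sum.inr l) * x))
  rw [mul_assoc]

variable {g}

theorem coe_scalarCurvIdx (k l : Fin n) (v : Fock A n) :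
    (scalarCurvIdx g (Sum.inl k) (Sum.inr l) v : Wick A n) =
      -(ofFn n (g k l) * nuPow A n (-1) * v) := by
  change ofFormalFn n (Complex.I • HahnSeries.single (-1) (Complex.I • g k l)) * (v : Wick A n) = _
  rw [show Complex.I • (HahnSeries.single (-1) (Complex.I • g k l) : Laurent A) =
      HahnSeries.single (-1) (Complex.I • Complex.I • g k l) from
      ((HahnSeries.single.linearMap (R := ℂ) (-1)).map_smul _ _).symm, smul_smul,
    Complex.I_mul_I, neg_one_smul, ofFormalFn_single,
    ofFn_neg]
  ring

theorem coe_nuInvFib_mul_hatFib_ofFn (a : A) (v : Fock A n) :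
    ((nuInvFib A n * hatFib g (ofFn n a)) v : Wick A n) = ofFn n a * nuPow A n (-1) * v := by
  rw [Module.End.mul_apply, coe_nuInvFib, coe_hatFib,
    wick_of_fibDeriv_inr_inr_eq_zero g (by simp)]
  simp only [fibDeriv_ofFn, zero_mul, mul_zero, Finset.sum_const_zero, add_zero, projV_mul,
    projV_ofFn, projV_of_mem v.2]
  ring

/-- `∂_i ϑ_j` is `∓g_{kl}` for mixed types and zero otherwise. It is antisymmetric, whereas
`scalarCurvIdx` keeps only the `dz^k ∧ dz̄^l` half, so the former is the antisymmetrisation of the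
latter; the sign comes from `i² = -1`. -/
theorem nuInvFib_mul_hatFib_fibDeriv_thetaIdx (i j : Idx n) :
    nuInvFib A n * hatFib g (fibDeriv A i (thetaIdx g j)) + scalarCurvIdx g j i =
      scalarCurvIdx g i j := by
  rcases i with p | p <;> rcases j with q | q
  · simp [scalarCurvIdx]
  · refine LinearMap.ext fun v => Subtype.ext ?_
    rw [fibDeriv_inl_thetaIdx_inr, ← ofFn_neg, LinearMap.add_apply, Submodule.coe_add,
      coe_nuInvFib_mul_hatFib_ofFn, coe_scalarCurvIdx, ofFn_neg]
    change _ + ((0 : Fock A n) : Wick A n) = _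
    rw [Submodule.coe_zero]
    ring
  · refine LinearMap.ext fun v => Subtype.ext ?_
    rw [fibDeriv_inr_thetaIdx_inl, LinearMap.add_apply, Submodule.coe_add,
      coe_nuInvFib_mul_hatFib_ofFn, coe_scalarCurvIdx]
    change _ = ((0 : Fock A n) : Wick A n)
    rw [Submodule.coe_zero]
    ring
  · simp [scalarCurvIdx]

variable {d}

/-- The curvature of the connection `D̂` over a coordinate chart. -/
theorem IsKahlerData.dHat_mul_dHat (H : IsKahlerData d g) {w : WickForms A n}
    (hw : w ∈ formsOfDegree A n 1)
    (h : delta A n w = curvR d g + nabla d g w + nuInvWick A n (circ g w w)) :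
    dHat d g w * dHat d g w = scalarMul A n (Complex.I • omegaForm g) := by
  obtain ⟨r, rfl⟩ := exists_eq_sum_tmul_dx hw
  have h1 := congrArg (hat g) (fedosovIdx_of_fedosov_eq d g h)
  rw [hat_sum_tmul, map_zero] at h1
  -- Fedosov's equation, acting on the Fock space and multiplied by `ν⁻¹`.
  have h2 : twoFormOp (fun i j =>
      nuInvFib A n * hatFib g (curvIdx d g i j + fedosovIdx d g r i j)) = 0 := by
    have h3 := congrArg (fun x => nuInvFock A n * x) h1
    simp only [twoFormOp, Finset.mul_sum, nuInvFock_eq, mul_zero] at h3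
    rw [twoFormOp, ← h3]
    refine Finset.sum_congr rfl fun i _ => Finset.sum_congr rfl fun j _ => ?_
    rw [Module.End.mul_eq_comp, Module.End.mul_eq_comp, ← TensorProduct.map_comp,
      LinearMap.id_comp]
  rw [dHat_eq_sum, sum_map_wedge_mul_self, scalarMul_omegaForm]
  have h4 : twoFormOp (fun i j => dHatIdx d g r i * dHatIdx d g r j) =
      twoFormOp fun i j => scalarCurvIdx g i j +
        nuInvFib A n * hatFib g (curvIdx d g i j + fedosovIdx d g r i j) := by
    refine twoFormOp_eq_of_add_swap fun i j => ?_
    rw [← nuInvFib_mul_hatFib_fibDeriv_thetaIdx i j, add_comm (scalarCurvIdx g j i), ← add_assoc,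
      H.dHatIdx_commutator]
    abel
  rw [h4, twoFormOp_add, h2, add_zero]

end Forms

/-! ## Smooth functions on coordinate charts -/

section SmoothFunctions

variable {n : ℕ} {O : TopologicalSpace.Opens (Fin n → ℂ)}

theorem dirDeriv_apply (v : Fin n → ℂ) (f : SmoothFn O) (z : O) :
    (dirDeriv O v f).1 z = fderiv ℝ (extendZero O f.1) z v := rfl

theorem dirDeriv_mul (v : Fin n → ℂ) (f h : SmoothFn O) :
    dirDeriv O v (f * h) = dirDeriv O v f * h + f * dirDeriv O v h := by
  apply Subtype.ext
  funext z
  have he : extendZero O (f * h).1 =ᶠ[nhds z.1] extendZero O f.1 * extendZero O h.1 := by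
    filter_upwards [O.isOpen.mem_nhds z.2] with y hy
    simp [extendZero_apply _ hy]
  change fderiv ℝ (extendZero O (f * h).1) z v = fderiv ℝ (extendZero O f.1) z v * h.1 z +
    f.1 z * fderiv ℝ (extendZero O h.1) z v
  rw [he.fderiv_eq, fderiv_mul (smoothFn_differentiableAt f z.2) (smoothFn_differentiableAt h z.2)]
  simp only [add_apply, smul_apply, smul_eq_mul,
    extendZero_apply _ z.2]
  ring

/-- Extension by zero does not affect derivatives at points of the open set `O`. Symmetry of the
second derivative then yields `dirDeriv_comm`. -/
theorem dirDeriv_dirDeriv_apply (u v : Fin n → ℂ) (f : SmoothFn O) (z : O) :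
    (dirDeriv O u (dirDeriv O v f)).1 z = fderiv ℝ (fderiv ℝ (extendZero O f.1)) z u v := by
  have he : extendZero O (dirDeriv O v f).1 =ᶠ[nhds z.1]
      fun y => fderiv ℝ (extendZero O f.1) y v := by
    filter_upwards [O.isOpen.mem_nhds z.2] with y hy
    exact extendZero_apply _ hy
  have hd : DifferentiableAt ℝ (fderiv ℝ (extendZero O f.1)) z :=
    ((f.2.contDiffAt (O.isOpen.mem_nhds z.2)).fderiv_right (m := 1)
      (WithTop.coe_le_coe.2 (le_top : (1 + 1 : ℕ∞) ≤ ⊤))).differentiableAt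
      one_ne_zero
  rw [dirDeriv_apply, he.fderiv_eq, fderiv_clm_apply hd (differentiableAt_const v)]
  simp

theorem dirDeriv_comm (u v : Fin n → ℂ) (f : SmoothFn O) :
    dirDeriv O u (dirDeriv O v f) = dirDeriv O v (dirDeriv O u f) := by
  apply Subtype.ext
  funext z
  rw [dirDeriv_dirDeriv_apply, dirDeriv_dirDeriv_apply]
  exact (f.2.contDiffAt (O.isOpen.mem_nhds z.2)).isSymmSndFDerivAt (by
    rw [minSmoothness_of_isRCLikeNormedField]
    exact WithTop.coe_le_coe.2 (le_top : (2 : ℕ∞) ≤ ⊤)) u v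

/-- Treats `∂/∂z^k` and `∂/∂z̄^l` uniformly, so that the Leibniz rule and commutation follow from
those of real directional derivatives. -/
theorem exists_wirtinger_eq (i : Idx n) : ∃ (a b : ℂ) (u v : Fin n → ℂ),
    wirtinger O i = a • dirDeriv O u + b • dirDeriv O v := by
  rcases i with k | k
  · exact ⟨1 / 2, -(1 / 2 * Complex.I), Pi.single k 1, Pi.single k Complex.I,
      by simp only [wirtinger]; module⟩
  · exact ⟨1 / 2, 1 / 2 * Complex.I, Pi.single k 1, Pi.single k Complex.I,
      by simp only [wirtinger]; module⟩

theorem wirtinger_mul (i : Idx n) (f h : SmoothFn O) :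
    wirtinger O i (f * h) = wirtinger O i f * h + f * wirtinger O i h := by
  obtain ⟨a, b, u, v, hi⟩ := exists_wirtinger_eq (O := O) i
  simp only [hi, LinearMap.smul_apply, LinearMap.add_apply, dirDeriv_mul, smul_add, add_mul,
    mul_add, smul_mul_assoc, mul_smul_comm]
  abel

theorem wirtinger_comm (i j : Idx n) (f : SmoothFn O) :
    wirtinger O i (wirtinger O j f) = wirtinger O j (wirtinger O i f) := by
  have key : ∀ (a b c d : ℂ) (u v u' v' : Fin n → ℂ),
      (a • dirDeriv O u + b • dirDeriv O v) ((c • dirDeriv O u' + d • dirDeriv O v') f) =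
      (c • dirDeriv O u' + d • dirDeriv O v') ((a • dirDeriv O u + b • dirDeriv O v) f) := by
    intro a b c d u v u' v'
    simp only [LinearMap.add_apply, LinearMap.smul_apply, map_add, map_smul,
      dirDeriv_comm u', dirDeriv_comm v']
    module
  obtain ⟨a, b, u, v, h1⟩ := exists_wirtinger_eq (O := O) i
  obtain ⟨c, d, u', v', h2⟩ := exists_wirtinger_eq (O := O) j
  rw [h1, h2, key]

theorem isUnit_of_forall_ne_zero {f : SmoothFn O} (hf : ∀ z, f.1 z ≠ 0) : IsUnit f := by
  refine IsUnit.of_mul_eq_one ⟨fun z => (f.1 z)⁻¹, ?_⟩ ?_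
  · have h1 : ContDiffOn ℝ ∞ (fun z => (extendZero O f.1 z)⁻¹) (O : Set (Fin n → ℂ)) :=
      ContDiffOn.inv f.2 fun z hz => by
        rw [extendZero_apply _ hz]
        exact hf _
    refine h1.congr fun z hz => ?_
    rw [extendZero_apply _ hz, extendZero_apply _ hz]
  · apply Subtype.ext
    funext z
    exact mul_inv_cancel₀ (hf z)

end SmoothFunctions

/-! ## Kähler metrics -/

section KahlerManifold

variable {n : ℕ} {M : Type*} [TopologicalSpace M] [ChartedSpace (Fin n → ℂ) M]

theorem HoloChart.mfderiv_symm_eq_sum (e : HoloChart n M) (z : Fin n → ℂ) (c : Fin n → ℂ) :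
    mfderiv 𝓘(ℂ, Fin n → ℂ) 𝓘(ℂ, Fin n → ℂ) e.1.symm z c = ∑ k, c k • e.frame z k := by
  have h : c = ∑ k, c k • (Pi.single k 1 : Fin n → ℂ) := pi_eq_sum_univ' c
  conv_lhs => rw [h]
  exact (map_sum (mfderiv 𝓘(ℂ, Fin n → ℂ) 𝓘(ℂ, Fin n → ℂ) e.1.symm z) _ _).trans
    (Finset.sum_congr rfl fun k _ => map_smul _ _ _)

/-- The combination is the image of `c` under the differential of the inverse chart, which is
injective. -/
theorem HoloChart.sum_frame_ne_zero [IsManifold 𝓘(ℂ, Fin n → ℂ) ω M] (e : HoloChart n M)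
    {z : Fin n → ℂ} (hz : z ∈ e.dom) {c : Fin n → ℂ} (hc : c ≠ 0) :
    ∑ k, c k • e.frame z k ≠ 0 := by
  have hd : e.1.MDifferentiable 𝓘(ℂ, Fin n → ℂ) 𝓘(ℂ, Fin n → ℂ) :=
    ⟨(contMDiffOn_of_mem_maximalAtlas e.2).mdifferentiableOn (by simp),
      (contMDiffOn_symm_of_mem_maximalAtlas e.2).mdifferentiableOn (by simp)⟩
  rw [← e.mfderiv_symm_eq_sum]
  intro h0
  exact hc (hd.symm.mfderiv_injective hz (h0.trans (map_zero _).symm))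

theorem HermitianMetric.isUnit_det_comp [IsManifold 𝓘(ℂ, Fin n → ℂ) ω M]
    (m : HermitianMetric n M) (e : HoloChart n M) : IsUnit (m.comp e).det := by
  refine isUnit_of_forall_ne_zero fun z h0 => ?_
  have h1 : ((m.comp e).map fun f => f.1 z).det = 0 := by
    rw [← h0]
    exact (RingHom.map_det ((Pi.evalRingHom (fun _ : e.dom => ℂ) z).comp
      (SmoothFn e.dom).toSubring.subtype) (m.comp e)).symm
  -- A null row vector `c` of `g` at `z` would give the nonzero tangent vector `u = ∑ c^k ∂/∂z^k`
  -- with `h(u, u) = 0`, against positivity.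
  obtain ⟨c, hc, hcg⟩ := Matrix.exists_vecMul_eq_zero_iff.2 h1
  have h2 := m.pos _ _ (e.sum_frame_ne_zero z.2 hc)
  have h3 : m.h (e.1.symm z) (∑ k, c k • e.frame z k) (∑ k, c k • e.frame z k) = 0 := by
    simp only [map_sum, map_smulₛₗ, LinearMap.sum_apply, LinearMap.smul_apply, smul_eq_mul]
    refine Finset.sum_eq_zero fun l _ => ?_
    have h4 : ∑ k, c k * m.h (e.1.symm z) (e.frame z k) (e.frame z l) = 0 := congrFun hcg l
    exact mul_eq_zero_of_right _ h4
  rw [h3] at h2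
  exact lt_irrefl _ h2

theorem KahlerMetric.isKahlerData [IsManifold 𝓘(ℂ, Fin n → ℂ) ω M] (m : KahlerMetric n M)
    (e : HoloChart n M) : IsKahlerData (wirtinger e.dom) (m.comp e) where
  leibniz := wirtinger_mul
  comm := wirtinger_comm
  isUnit_det := m.isUnit_det_comp e
  hol := m.closed_hol e
  bar := m.closed_bar e

end KahlerManifold

end FockBundle

end

open FockBundle in
/-- On a Kähler manifold `M`, for the element `r` of Fedosov's construction of Wick type, the
connection `D̂ = ∇̂ + (1/ν) γ̂`, `γ = -ϑ + r`, on the formal Fock bundle satisfies `D̂² = i ω` with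
`ω = (1/ν) ω₋₁`, as operators on local Fock-bundle valued forms over every holomorphic chart. -/
theorem proposition2 {n : ℕ} {M : Type*} [TopologicalSpace M] [ChartedSpace (Fin n → ℂ) M]
    [IsManifold 𝓘(ℂ, Fin n → ℂ) ω M] (m : KahlerMetric n M) (r : WickSection n M)
    (hr : IsFedosovElement m r) (e : HoloChart n M) :
    dHat (wirtinger e.dom) (m.comp e) (r.loc e) * dHat (wirtinger e.dom) (m.comp e) (r.loc e) =
      scalarMul e.Fn n (Complex.I • omegaForm (m.comp e)) :=
  (m.isKahlerData e).dHat_mul_dHat (hr.degree_one e) (hr.fedosov_eq e)
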